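/- Let $d\ge 2$ and $1\le k\le d$ be integers and let $A\in\mathbb R^{d\times d}$ be symmetric with spectral norm $\|A\|=1$ and nonnegative diagonal entries. Let $x^*$ maximize $x^\top A x$ over the vectors $x\in\mathbb R^d$ with $\|x\|_2=1$ and at most $k$ nonzero entries. Let $W^*$ be an $\epsilon$-approximate optimal solution of the semidefinite program of maximizing $\operatorname{tr}(AW)$ subject to $\operatorname{tr}W=1$, $\sum_{i,j}|W_{ij}|\le k$, $W\succeq 0$; that is, $W^*$ is feasible and $\operatorname{tr}(AW^*)\ge \operatorname{tr}(AW)-\epsilon$ for every feasible $W$. **Algorithm** (input $A$, $W\succeq0$, $k$). Put $a_i=\sqrt{W_{ii}}$ and $$p_i=\min\Big\{1,\ \frac23\cdot\frac{k\,a_i}{\sum_j a_j}+\frac1{12}\cdot\frac{k\,A_{ii}}{\operatorname{tr}A}\Big\}$$ (a quotient $0/0$ counts as $0$). Draw independent $\epsilon_i\in\{0,1\}$ with $\mathbb P(\epsilon_i=1)=p_i$ and let $S=\{i:\epsilon_i=1\}$. If $A\succeq0$ and $|S|<k$, let $R\supseteq S$ be a set with $|R|=k$, chosen in an arbitrary way;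 otherwise let $R=S$. The output is a vector $z$ that vanishes outside $R$ and whose restriction to $R$ maximizes $y^\top A_{R,R}\,y$ over unit vectors $y$ (with $z=0$ if $R=\emptyset$). **Events and constants.** Let $g\in\mathbb R^d$ have i.i.d. entries uniform on $[-\sqrt3,\sqrt3]$, independent of $(\epsilon_i)_i$. For $C>0$ and $W\succeq 0$ with $\sqrt W=(u_1,\dots,u_d)$ put $$\mathcal A=\{|S|\le k\},\qquad \mathcal B=\mathcal B_C=\Big\{\max_{i:\,u_i\neq0}\frac{|u_i^\top g|^2}{\|u_i\|^2}\le C\log d\Big\}.$$ There is an absolute constant $c>0$ such that $\mathbb P(\mathcal A)\ge1-e^{-ck}$ for all $d$, all $k\ge 1$, all symmetric $A$ with nonnegative diagonal and all $W\succeq0$; and there is an absolute constant $C>0$ such that $\mathbb P(\mathcal B_C)\ge1-2d^{-3}$ for all $d\ge1$ and all $W\succeq0$. **Theorem.** The constants $c$ and $C$ just described exist. There is an absolute constant $K>0$ such that, for all such constants $c,C$ and all $d,k,A,x^*,\epsilon,W^*$ as above, if $z$ is the (random) output of the algorithm with input $(A,W^*,k)$ and $\mathcal A$, $\mathcal B$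 are the events for $W=W^*$, then $\mathbb P(\mathcal A\cap\mathcal B)>0$ and: 1. $$C\log d\,\Big[1+\frac{9\big(\sum_{i=1}^d\sqrt{W^*_{ii}}\big)^2}{4k}\Big]\,\mathbb E\big[z^\top Az\,\big|\,\mathcal A\cap\mathcal B\big]\ \ge\ \Big(1-\frac Kd\Big)(x^*)^\top Ax^*-\epsilon-e^{-ck+2\log(2d/k)}.$$ 2. If, in addition, $A$ is positive semidefinite and $ck\ge3\log(d/k)+\log\log d$, then $$C\log d\,\Big[1+\frac{9\big(\sum_{i=1}^d\sqrt{W^*_{ii}}\big)^2}{4k}\Big]\,\mathbb E\big[z^\top Az\,\big|\,\mathcal A\cap\mathcal B\big]\ \ge\ \Big(1-\frac K{\log d}\Big)(x^*)^\top Ax^*-\epsilon.$$ -/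

import Mathlib

open MeasureTheory ProbabilityTheory
open scoped Matrix MatrixOrder

universe u

namespace SparsePCA

noncomputable section

/-- The quadratic form `xᵀ A x`. -/
def quadForm {d : ℕ} (A : Matrix (Fin d) (Fin d) ℝ) (x : EuclideanSpace ℝ (Fin d)) : ℝ :=
  x.ofLp ⬝ᵥ (A *ᵥ x.ofLp)

/-- The number of nonzero entries of `x`. -/
def zeroNorm {d : ℕ} (x : EuclideanSpace ℝ (Fin d)) : ℕ :=
  (Finset.univ.filter fun i => x i ≠ 0).card

/-- The feasible points of sparse PCA: `k`-sparse unit vectors. -/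
def IsFeasible {d : ℕ} (k : ℕ) (x : EuclideanSpace ℝ (Fin d)) : Prop :=
  ‖x‖ = 1 ∧ zeroNorm x ≤ k

/-- `x` is an optimal solution to sparse PCA with input `(A, k)`. -/
def IsOptimal {d : ℕ} (A : Matrix (Fin d) (Fin d) ℝ) (k : ℕ)
    (x : EuclideanSpace ℝ (Fin d)) : Prop :=
  IsFeasible k x ∧ ∀ y : EuclideanSpace ℝ (Fin d), IsFeasible k y → quadForm A y ≤ quadForm A x

/-- The feasible set of the basic semidefinite relaxation:
`W ⪰ 0`, `tr W = 1`, and the entrywise 1-norm of `W` is at most `k`. -/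
def IsSDPFeasible {d : ℕ} (k : ℕ) (W : Matrix (Fin d) (Fin d) ℝ) : Prop :=
  W.PosSemidef ∧ W.trace = 1 ∧ ∑ i, ∑ j, |W i j| ≤ (k : ℝ)

/-- `W` is an `ε`-approximate optimal solution to the relaxation, whose objective is `tr (A W)`. -/
def IsApproxSDPOptimal {d : ℕ} (A : Matrix (Fin d) (Fin d) ℝ) (k : ℕ) (ε : ℝ)
    (W : Matrix (Fin d) (Fin d) ℝ) : Prop :=
  IsSDPFeasible k W ∧
    ∀ W' : Matrix (Fin d) (Fin d) ℝ, IsSDPFeasible k W' → (A * W').trace - ε ≤ (A * W).trace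

/-- The sum of the square roots of the diagonal entries of `W`. -/
def sqrtDiagSum {d : ℕ} (W : Matrix (Fin d) (Fin d) ℝ) : ℝ :=
  ∑ j, √(W j j)

/-- The probability with which the algorithm includes index `i`.  A quotient with zero
denominator counts as `0`; for a nonnegative diagonal this occurs only if all the numerators
vanish as well. -/
def inclusionProb {d : ℕ} (A W : Matrix (Fin d) (Fin d) ℝ) (k : ℕ) (i : Fin d) : ℝ :=
  min 1 (2 / 3 * (k * √(W i i) / sqrtDiagSum W) + 1 / 12 * (k * A i i / A.trace))

variable {Ω : Type u} [MeasurableSpace Ω]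

/-- `b i` are independent coin flips, `b i` being heads with probability `p i`. -/
structure IsCoinSample {d : ℕ} (μ : Measure Ω) (p : Fin d → ℝ) (b : Fin d → Ω → Bool) :
    Prop where
  measurable : ∀ i, Measurable (b i)
  prob : ∀ i, μ {ω | b i ω = true} = ENNReal.ofReal (p i)
  indep : iIndepFun b μ

/-- `g i` are independent, each uniformly distributed on `[-√3, √3]`. -/
structure IsUniformSample {d : ℕ} (μ : Measure Ω) (g : Fin d → Ω → ℝ) : Prop where
  measurable : ∀ i, Measurable (g i)
  uniform : ∀ i, pdf.IsUniform (g i) (Set.Icc (-√3) √3) μ volume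
  indep : iIndepFun g μ

/-- The set of indices whose coin shows heads. -/
def sampledSet {d : ℕ} (b : Fin d → Ω → Bool) (ω : Ω) : Finset (Fin d) :=
  Finset.univ.filter fun i => b i ω = true

/-- `z` is a possible output of the algorithm once the coin flips have produced the index set `S`.
If `A ⪰ 0` and `S` has fewer than `k` elements, then `S` is first enlarged, in an arbitrary
manner, to a set `R` with `k` elements; otherwise `R = S`.  The output starts as the zero vector,
and its restriction to `R` is then replaced by a maximizer of `yᵀ A_{R,R} y` over unit
vectors `y` indexed by `R` (there is none if `R` is empty, and `z` stays zero). -/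
def IsOutput {d : ℕ} (A : Matrix (Fin d) (Fin d) ℝ) (k : ℕ) (S : Finset (Fin d))
    (z : EuclideanSpace ℝ (Fin d)) : Prop :=
  ∃ R : Finset (Fin d),
    (A.PosSemidef ∧ S.card < k → S ⊆ R ∧ R.card = k) ∧
    (¬ (A.PosSemidef ∧ S.card < k) → R = S) ∧
    (∀ i, i ∉ R → z i = 0) ∧
    (R.Nonempty → ‖z‖ = 1 ∧
      ∀ y : EuclideanSpace ℝ (Fin d), ‖y‖ = 1 → (∀ i, i ∉ R → y i = 0) →
        quadForm A y ≤ quadForm A z)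

/-- The event that the sampled index set has at most `k` elements. -/
def sparseEvent {d : ℕ} (k : ℕ) (b : Fin d → Ω → Bool) : Set Ω :=
  {ω | (sampledSet b ω).card ≤ k}

/-- The event `max |uᵢᵀ g|² / ‖uᵢ‖² ≤ C log d`, the maximum being over the nonzero columns `uᵢ`
of the positive semidefinite square root of `W`. -/
def maxBoundEvent {d : ℕ} (C : ℝ) (W : Matrix (Fin d) (Fin d) ℝ) (g : Fin d → Ω → ℝ) : Set Ω :=
  {ω | ∀ i, 0 < ∑ j, (CFC.sqrt W j i) ^ 2 →
    (∑ j, CFC.sqrt W j i * g j ω) ^ 2 / ∑ j, (CFC.sqrt W j i) ^ 2 ≤ C * Real.log d}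

/-- `c` is an absolute constant for which, whatever the input of the algorithm, at most `k`
indices are sampled with probability at least `1 - exp (-c k)`. -/
def IsSparsityConstant (c : ℝ) : Prop :=
  0 < c ∧ ∀ (d k : ℕ) (A W : Matrix (Fin d) (Fin d) ℝ) (Ω : Type u) [MeasurableSpace Ω]
    (μ : Measure Ω) [IsProbabilityMeasure μ] (b : Fin d → Ω → Bool),
    0 < k → A.IsSymm → (∀ i, 0 ≤ A i i) → W.PosSemidef →
    IsCoinSample μ (inclusionProb A W k) b →
    1 - Real.exp (-c * k) ≤ μ.real (sparseEvent k b)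

/-- `C` is an absolute constant for which, whatever the matrix `W ⪰ 0`, the max-bound event has
probability at least `1 - 2 d⁻³`. -/
def IsMaxBoundConstant (C : ℝ) : Prop :=
  0 < C ∧ ∀ (d : ℕ) (W : Matrix (Fin d) (Fin d) ℝ) (Ω : Type u) [MeasurableSpace Ω]
    (μ : Measure Ω) [IsProbabilityMeasure μ] (g : Fin d → Ω → ℝ),
    0 < d → W.PosSemidef → IsUniformSample μ g →
    1 - 2 / (d : ℝ) ^ 3 ≤ μ.real (maxBoundEvent C W g)

end

end SparsePCA

/-!
The algorithm is compared with a randomized rounding that it never performs. Let `uᵢ` be the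
columns of `√W` and let `y` be the vector with entries `yᵢ = εᵢ uᵢᵀ g / pᵢ`, which is supported on
the sampled set. The output `z` is optimal on a larger support, so `yᵀ A y ≤ ‖y‖² zᵀ A z`
(`IsOutput.quadForm_le`). On the good event at most `k` coordinates are sampled and every
`(uᵢᵀ g)²` is at most `C log d * Wᵢᵢ`; as `pᵢ` is at least `min 1 (2 k √Wᵢᵢ / (3 ∑ⱼ √Wⱼⱼ))`, this
bounds `‖y‖²` by the factor on the left-hand side of the theorem (`norm_sq_roundedVec_le`). Since
`zᵀ A z ≥ 0`, conditioning costs nothing, and it remains to bound the integral of `yᵀ A y` over the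
good event from below.

Averaging over the coins turns `y` into `v = (uᵢᵀ g)ᵢ`, up to diagonal terms of the right sign, and
`E (vᵀ A v) = tr (A W)` because `g` has identity covariance. Two errors arise from restricting to
the good event (`trace_sub_le_setIntegral_quadForm_roundedVec`). Where too many indices are
sampled, `yᵀ A y ≤ ‖y‖²` has integral at most `exp (-c k) ∑ᵢ Wᵢᵢ / pᵢ² ≤ exp (-c k) (2 d / k)²`.
Where some `uᵢᵀ g` is large, `vᵀ A v ≤ ‖v‖² ≤ tr W ‖g‖² ≤ 3 d` on an event of probability at most
`2 / d³`, which gives an error `6 / d²`.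

The second error is absorbed by the optimum `Q = xᵀ A x` when `Q ≥ 1 / d`. This holds for `k ≥ 2`,
where `Q` dominates all entries of `A` (`IsOptimal.abs_apply_le`). For `k = 1` the optimum may
vanish, but then `W` is diagonal and `y` has at most one nonzero entry on the good event, so `A` may
be replaced by its diagonal, whose form is at most `Q ‖·‖²`; the error becomes `6 Q / d²`
(`IsOptimal.exists_reduced_matrix`). If `A` is positive semidefinite, then `Q ≥ k / d`
(`IsOptimal.div_le_of_posSemidef`), and the hypothesis on `c k` makes the first error at most
`4 Q / log d`.

The two absolute constants come from a Chernoff bound for `∑ᵢ εᵢ`, whose mean is at most `3 k / 4`,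
and from Hoeffding's inequality together with a union bound over the columns.
-/

namespace SparsePCA

/-! ### Moments of the uniform distribution on `[-√3, √3]` -/

section Uniform

variable {Ω : Type u} [MeasurableSpace Ω] {μ : Measure Ω}

lemma integral_comp_of_isUniform {X : Ω → ℝ} (hX : Measurable X)
    (hu : pdf.IsUniform X (Set.Icc (-√3) √3) μ volume) {f : ℝ → ℝ} (hf : Measurable f) :
    ∫ ω, f (X ω) ∂μ = (2 * √3)⁻¹ * ∫ x in (-√3)..√3, f x := by
  have h0 : (0 : ℝ) ≤ √3 := Real.sqrt_nonneg 3
  rw [← integral_map (f := f) hX.aemeasurable hf.aestronglyMeasurable, hu, ProbabilityTheory.cond,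
    integral_smul_measure, Real.volume_Icc, intervalIntegral.integral_of_le (by linarith),
    integral_Icc_eq_integral_Ioc, ENNReal.toReal_inv,
    ENNReal.toReal_ofReal (by linarith), smul_eq_mul]
  congr 2
  ring

lemma integral_of_isUniform {X : Ω → ℝ} (hX : Measurable X)
    (hu : pdf.IsUniform X (Set.Icc (-√3) √3) μ volume) : ∫ ω, X ω ∂μ = 0 := by
  rw [integral_comp_of_isUniform hX hu (f := fun x => x) measurable_id]
  simp

lemma integral_sq_of_isUniform {X : Ω → ℝ} (hX : Measurable X)
    (hu : pdf.IsUniform X (Set.Icc (-√3) √3) μ volume) : ∫ ω, X ω ^ 2 ∂μ = 1 := by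
  have h3 : √3 ^ 2 = (3 : ℝ) := Real.sq_sqrt (by norm_num)
  have h0 : √3 ≠ (0 : ℝ) := by positivity
  rw [integral_comp_of_isUniform hX hu (f := fun x => x ^ 2) (measurable_id.pow_const 2)]
  simp only [integral_pow]
  field_simp
  rw [show ((2 : ℕ) : ℝ) + 1 = 3 by norm_num]
  have h33 : √3 ^ 3 = √3 * 3 := by rw [pow_succ, h3]; ring
  linear_combination 2 * h33

lemma ae_mem_Icc_of_isUniform {X : Ω → ℝ} (hX : Measurable X)
    (hu : pdf.IsUniform X (Set.Icc (-√3) √3) μ volume) :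
    ∀ᵐ ω ∂μ, X ω ∈ Set.Icc (-√3) √3 := by
  have h : ∀ᵐ x ∂(μ.map X), x ∈ Set.Icc (-√3) √3 := by
    rw [hu]
    exact ae_cond_mem measurableSet_Icc
  exact ae_of_ae_map hX.aemeasurable h

end Uniform

/-! ### Hoeffding bounds for linear forms -/

section Sample

variable {Ω : Type u} [MeasurableSpace Ω] {μ : Measure Ω} [IsProbabilityMeasure μ] {d : ℕ}
  {g : Fin d → Ω → ℝ}

omit [IsProbabilityMeasure μ] in
lemma IsUniformSample.ae_abs_le (hg : IsUniformSample μ g) :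
    ∀ᵐ ω ∂μ, ∀ i, |g i ω| ≤ √3 := by
  rw [ae_all_iff]
  intro i
  filter_upwards [ae_mem_Icc_of_isUniform (hg.measurable i) (hg.uniform i)] with ω hω
  exact abs_le.2 hω

omit [IsProbabilityMeasure μ] in
lemma IsUniformSample.integral_mul (hg : IsUniformSample μ g) (i j : Fin d) :
    ∫ ω, g i ω * g j ω ∂μ = if i = j then 1 else 0 := by
  split_ifs with h
  · subst h
    simpa only [sq] using integral_sq_of_isUniform (hg.measurable i) (hg.uniform i)
  · rw [(hg.indep.indepFun h).integral_fun_mul_eq_mul_integral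
      (hg.measurable i).aestronglyMeasurable (hg.measurable j).aestronglyMeasurable,
      integral_of_isUniform (hg.measurable i) (hg.uniform i), zero_mul]

lemma IsUniformSample.hasSubgaussianMGF_sum (hg : IsUniformSample μ g) (w : Fin d → ℝ) :
    HasSubgaussianMGF (fun ω => ∑ j, w j * g j ω) (Real.toNNReal (3 * ∑ j, w j ^ 2)) μ := by
  have h1 : ∀ j, HasSubgaussianMGF (fun ω => w j * g j ω) (Real.toNNReal (3 * w j ^ 2)) μ := by
    intro j
    have h := (hasSubgaussianMGF_of_mem_Icc_of_integral_eq_zero (hg.measurable j).aemeasurable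
      (ae_mem_Icc_of_isUniform (hg.measurable j) (hg.uniform j))
      (integral_of_isUniform (hg.measurable j) (hg.uniform j))).const_mul (w j)
    convert h using 1
    apply NNReal.coe_injective
    have h3 : √3 ^ 2 = (3 : ℝ) := Real.sq_sqrt (by norm_num)
    rw [Real.coe_toNNReal _ (by positivity)]
    change 3 * w j ^ 2 = w j ^ 2 * (‖√3 - -√3‖ / 2) ^ 2
    rw [sub_neg_eq_add, Real.norm_of_nonneg (by positivity)]
    linear_combination - w j ^ 2 * h3
  have h2 := HasSubgaussianMGF.sum_of_iIndepFun (s := Finset.univ)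
    (hg.indep.comp (fun j x => w j * x) (fun j => measurable_const_mul (w j)))
    (fun j _ => h1 j)
  convert h2 using 1
  · rfl
  rw [Finset.mul_sum, Real.toNNReal_sum_of_nonneg (fun j _ => by positivity)]

lemma measurableSet_maxBoundEvent (hg : ∀ i, Measurable (g i)) (C : ℝ)
    (W : Matrix (Fin d) (Fin d) ℝ) : MeasurableSet (maxBoundEvent C W g) := by
  have : maxBoundEvent C W g = ⋂ i, {ω | 0 < ∑ j, (CFC.sqrt W j i) ^ 2 →
      (∑ j, CFC.sqrt W j i * g j ω) ^ 2 / ∑ j, (CFC.sqrt W j i) ^ 2 ≤ C * Real.log d} := by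
    ext; simp [maxBoundEvent]
  rw [this]
  refine MeasurableSet.iInter fun i => ?_
  by_cases h : 0 < ∑ j, (CFC.sqrt W j i) ^ 2
  · simp only [h, true_imp_iff]
    refine measurableSet_le (by fun_prop) measurable_const
  · simp [h]

/-- Two-sided Hoeffding bound for a linear form in the uniform sample. -/
lemma IsUniformSample.measureReal_lt_sq_le (hg : IsUniformSample μ g) (w : Fin d → ℝ)
    (hw : 0 < ∑ j, w j ^ 2) {t : ℝ} (ht : 0 ≤ t) :
    μ.real {ω | t < (∑ j, w j * g j ω) ^ 2 / ∑ j, w j ^ 2} ≤ 2 * Real.exp (-t / 6) := by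
  set s := ∑ j, w j ^ 2 with hs
  have hsub := hg.hasSubgaussianMGF_sum w
  rw [← hs] at hsub
  have hc : ((Real.toNNReal (3 * s) : NNReal) : ℝ) = 3 * s := Real.coe_toNNReal _ (by positivity)
  have he : -√(t * s) ^ 2 / (2 * ((Real.toNNReal (3 * s) : NNReal) : ℝ)) = -t / 6 := by
    rw [hc, Real.sq_sqrt (by positivity)]
    field_simp
    ring
  have h1 := hsub.measure_ge_le (Real.sqrt_nonneg (t * s))
  have h2 := hsub.neg.measure_ge_le (Real.sqrt_nonneg (t * s))
  rw [he] at h1 h2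
  have hsubset : {ω | t < (∑ j, w j * g j ω) ^ 2 / s} ⊆
      {ω | √(t * s) ≤ ∑ j, w j * g j ω} ∪ {ω | √(t * s) ≤ (-fun ω => ∑ j, w j * g j ω) ω} := by
    intro ω hω
    have h3 : t * s < (∑ j, w j * g j ω) ^ 2 := (lt_div_iff₀ hw).1 hω
    have h4 : √(t * s) ≤ |∑ j, w j * g j ω| := Real.sqrt_le_iff.2 ⟨abs_nonneg _, by
      rw [sq_abs]; exact h3.le⟩
    rcases le_abs.1 h4 with h | h
    · exact Or.inl h
    · exact Or.inr h
  calc _ ≤ _ := measureReal_mono hsubset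
    _ ≤ _ := measureReal_union_le _ _
    _ ≤ _ := by linarith

end Sample

/-- The constant `24` comes from a union bound over `d` columns, each of which exceeds the
threshold with probability at most `2 d ^ (-24 / 6)`. -/
theorem isMaxBoundConstant_twentyFour : IsMaxBoundConstant.{u} 24 := by
  refine ⟨by norm_num, ?_⟩
  intro d W Ω _ μ _ g hd _ hg
  have hdpos : (0 : ℝ) < d := by exact_mod_cast hd
  have hd1 : (1 : ℝ) ≤ d := by exact_mod_cast hd
  have hlog : 0 ≤ Real.log d := Real.log_nonneg hd1
  have hE := measurableSet_maxBoundEvent hg.measurable 24 W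
  have hcompl : μ.real (maxBoundEvent 24 W g)ᶜ ≤ 2 / (d : ℝ) ^ 3 := by
    have hsub : (maxBoundEvent 24 W g)ᶜ ⊆ ⋃ i, {ω | 0 < ∑ j, (CFC.sqrt W j i) ^ 2 ∧
        24 * Real.log d < (∑ j, CFC.sqrt W j i * g j ω) ^ 2 / ∑ j, (CFC.sqrt W j i) ^ 2} := by
      intro ω hω
      simpa [maxBoundEvent] using hω
    have hi : ∀ i, μ.real {ω | 0 < ∑ j, (CFC.sqrt W j i) ^ 2 ∧
        24 * Real.log d < (∑ j, CFC.sqrt W j i * g j ω) ^ 2 / ∑ j, (CFC.sqrt W j i) ^ 2}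
        ≤ 2 / (d : ℝ) ^ 4 := by
      intro i
      by_cases h : 0 < ∑ j, (CFC.sqrt W j i) ^ 2
      · simp only [h, true_and]
        refine (hg.measureReal_lt_sq_le (fun j => CFC.sqrt W j i) h (by positivity)).trans_eq ?_
        rw [show -(24 * Real.log d) / 6 = -(4 * Real.log d) by ring, Real.exp_neg,
          show 4 * Real.log d = ((4 : ℕ) : ℝ) * Real.log d by norm_num, Real.exp_nat_mul,
          Real.exp_log hdpos, div_eq_mul_inv]
      · simp only [h, false_and, Set.ofPred_false, measureReal_empty]
        positivity
    calc μ.real (maxBoundEvent 24 W g)ᶜ ≤ _ := measureReal_mono hsub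
      _ ≤ _ := measureReal_iUnion_fintype_le _
      _ ≤ ∑ _i : Fin d, 2 / (d : ℝ) ^ 4 := Finset.sum_le_sum fun i _ => hi i
      _ = 2 / (d : ℝ) ^ 3 := by
        rw [Finset.sum_const, Finset.card_univ, Fintype.card_fin, nsmul_eq_mul]
        field_simp
  rw [measureReal_compl hE, probReal_univ] at hcompl
  linarith

/-! ### A Chernoff bound for the number of sampled indices -/

section Coins

variable {Ω : Type u} [MeasurableSpace Ω] {μ : Measure Ω} [IsProbabilityMeasure μ] {d : ℕ}
  {p : Fin d → ℝ} {b : Fin d → Ω → Bool}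

/-- The indicator of heads. -/
def headsIndicator (x : Bool) : ℝ := if x = true then 1 else 0

lemma measurable_headsIndicator : Measurable headsIndicator := measurable_of_countable _

lemma headsIndicator_nonneg (x : Bool) : 0 ≤ headsIndicator x := by
  unfold headsIndicator; split_ifs <;> norm_num

lemma headsIndicator_le_one (x : Bool) : headsIndicator x ≤ 1 := by
  unfold headsIndicator; split_ifs <;> norm_num

lemma headsIndicator_sq (x : Bool) : headsIndicator x * headsIndicator x = headsIndicator x := by
  unfold headsIndicator; split_ifs <;> norm_num

omit [IsProbabilityMeasure μ] in
lemma IsCoinSample.integral_headsIndicator (hb : IsCoinSample μ p b) (hp : ∀ i, 0 ≤ p i)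
    (i : Fin d) : ∫ ω, headsIndicator (b i ω) ∂μ = p i := by
  have hm : MeasurableSet {ω | b i ω = true} := hb.measurable i (measurableSet_singleton true)
  have : (fun ω => headsIndicator (b i ω)) = Set.indicator {ω | b i ω = true} 1 := by
    ext ω
    simp [headsIndicator, Set.indicator]
  rw [this, integral_indicator_one hm, Measure.real, hb.prob i, ENNReal.toReal_ofReal (hp i)]

omit [IsProbabilityMeasure μ] in
lemma IsCoinSample.integral_headsIndicator_mul (hb : IsCoinSample μ p b) (hp : ∀ i, 0 ≤ p i)
    (i j : Fin d) : ∫ ω, headsIndicator (b i ω) * headsIndicator (b j ω) ∂μ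
      = if i = j then p i else p i * p j := by
  split_ifs with h
  · subst h
    simp only [headsIndicator_sq, hb.integral_headsIndicator hp]
  · rw [(hb.indep.indepFun h).integral_fun_comp_mul_comp (hb.measurable i).aemeasurable
      (hb.measurable j).aemeasurable measurable_headsIndicator.aestronglyMeasurable
      measurable_headsIndicator.aestronglyMeasurable,
      hb.integral_headsIndicator hp, hb.integral_headsIndicator hp]

omit [MeasurableSpace Ω] in
lemma card_sampledSet (b : Fin d → Ω → Bool) (ω : Ω) :
    ((sampledSet b ω).card : ℝ) = ∑ i, headsIndicator (b i ω) := by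
  simp [sampledSet, headsIndicator]

lemma measurableSet_sparseEvent (hb : ∀ i, Measurable (b i)) (k : ℕ) :
    MeasurableSet (sparseEvent k b) := by
  have : sparseEvent k b = {ω | ∑ i, headsIndicator (b i ω) ≤ (k : ℝ)} := by
    ext ω
    simp only [sparseEvent, Set.mem_ofPred_eq, ← card_sampledSet, Nat.cast_le]
  rw [this]
  exact measurableSet_le (Finset.measurable_sum _ fun i _ =>
    measurable_headsIndicator.comp (hb i)) measurable_const

/-- Chernoff bound for the number of heads. -/
lemma IsCoinSample.measureReal_compl_sparseEvent_le (hb : IsCoinSample μ p b) (hp : ∀ i, 0 ≤ p i)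
    (k : ℕ) {t : ℝ} (ht : 0 ≤ t) :
    μ.real (sparseEvent k b)ᶜ ≤ Real.exp (-t * k + (Real.exp t - 1) * ∑ i, p i) := by
  set X : Fin d → Ω → ℝ := fun i ω => headsIndicator (b i ω) with hX
  have hXm : ∀ i, Measurable (X i) := fun i => measurable_headsIndicator.comp (hb.measurable i)
  have hind : iIndepFun X μ := hb.indep.comp (fun _ => headsIndicator)
    (fun _ => measurable_headsIndicator)
  have hmgf : ∀ i, mgf (X i) μ t = 1 + (Real.exp t - 1) * p i := by
    intro i
    have : (fun ω => Real.exp (t * X i ω)) = fun ω => 1 + (Real.exp t - 1) * X i ω := by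
      ext ω
      simp only [hX, headsIndicator]
      split_ifs <;> simp
    have hint : Integrable (X i) μ := Integrable.of_bound (hXm i).aestronglyMeasurable 1
      (Filter.Eventually.of_forall fun ω => by
        rw [Real.norm_of_nonneg (headsIndicator_nonneg _)]; exact headsIndicator_le_one _)
    rw [mgf, this, integral_add (integrable_const _) (hint.const_mul _), integral_const_mul,
      hb.integral_headsIndicator hp]
    simp
  have hexp : ∀ s : ℝ, Integrable (fun ω => Real.exp (s * (∑ i, X i) ω)) μ := by
    intro s
    refine Integrable.of_bound (Measurable.aestronglyMeasurable (by fun_prop))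
      (Real.exp (|s| * d)) (Filter.Eventually.of_forall fun ω => ?_)
    rw [Real.norm_of_nonneg (Real.exp_pos _).le, Real.exp_le_exp]
    have h1 : |(∑ i, X i) ω| ≤ d := by
      rw [Finset.sum_apply]
      refine (Finset.abs_sum_le_sum_abs _ _).trans ?_
      calc ∑ i, |X i ω| ≤ ∑ _i : Fin d, (1 : ℝ) := Finset.sum_le_sum fun i _ => by
            rw [abs_of_nonneg (headsIndicator_nonneg _)]; exact headsIndicator_le_one _
        _ = d := by simp
    calc s * (∑ i, X i) ω ≤ |s * (∑ i, X i) ω| := le_abs_self _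
      _ = |s| * |(∑ i, X i) ω| := abs_mul _ _
      _ ≤ |s| * d := by gcongr
  have hsub : (sparseEvent k b)ᶜ ⊆ {ω | (k : ℝ) ≤ (∑ i, X i) ω} := by
    intro ω hω
    have h1 : k < (sampledSet b ω).card := by simpa [sparseEvent] using hω
    have h2 : (k : ℝ) < (sampledSet b ω).card := by exact_mod_cast h1
    rw [card_sampledSet] at h2
    simp only [Set.mem_ofPred_eq, Finset.sum_apply]
    exact h2.le
  calc μ.real (sparseEvent k b)ᶜ ≤ μ.real {ω | (k : ℝ) ≤ (∑ i, X i) ω} := measureReal_mono hsub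
    _ ≤ Real.exp (-t * k) * mgf (∑ i, X i) μ t := measure_ge_le_exp_mul_mgf _ ht (hexp t)
    _ ≤ Real.exp (-t * k) * Real.exp ((Real.exp t - 1) * ∑ i, p i) := by
      rw [hind.mgf_sum hXm, Finset.mul_sum, Real.exp_sum]
      gcongr with i hi
      · exact fun i _ => mgf_nonneg
      · rw [hmgf i, add_comm]
        exact Real.add_one_le_exp _
    _ = _ := by rw [← Real.exp_add]

end Coins

/-! ### The expected number of sampled indices -/

section InclusionProb

variable {d : ℕ} {A W : Matrix (Fin d) (Fin d) ℝ}

lemma sqrtDiagSum_nonneg (W : Matrix (Fin d) (Fin d) ℝ) : 0 ≤ sqrtDiagSum W :=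
  Finset.sum_nonneg fun _ _ => Real.sqrt_nonneg _

lemma inclusionProb_nonneg (hA : ∀ i, 0 ≤ A i i) (W : Matrix (Fin d) (Fin d) ℝ) (k : ℕ)
    (i : Fin d) : 0 ≤ inclusionProb A W k i := by
  have h1 : 0 ≤ A.trace := Finset.sum_nonneg fun i _ => hA i
  have h2 := sqrtDiagSum_nonneg W
  have h3 := hA i
  unfold inclusionProb
  positivity

lemma sum_inclusionProb_le (hA : ∀ i, 0 ≤ A i i) (W : Matrix (Fin d) (Fin d) ℝ) (k : ℕ) :
    ∑ i, inclusionProb A W k i ≤ 3 / 4 * k := by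
  have h1 : ∑ i, k * √(W i i) / sqrtDiagSum W ≤ k := by
    rw [← Finset.sum_div, ← Finset.mul_sum]
    exact div_le_of_le_mul₀ (sqrtDiagSum_nonneg W) (by positivity) le_rfl
  have h2 : ∑ i, k * A i i / A.trace ≤ k := by
    rw [← Finset.sum_div, ← Finset.mul_sum]
    exact div_le_of_le_mul₀ (Finset.sum_nonneg fun i _ => hA i) (by positivity) le_rfl
  calc ∑ i, inclusionProb A W k i
      ≤ ∑ i, (2 / 3 * (k * √(W i i) / sqrtDiagSum W) + 1 / 12 * (k * A i i / A.trace)) :=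
        Finset.sum_le_sum fun i _ => min_le_right _ _
    _ ≤ 3 / 4 * k := by
        rw [Finset.sum_add_distrib, ← Finset.mul_sum, ← Finset.mul_sum]
        linarith

end InclusionProb

/-- The expected number of sampled indices is at most `3 k / 4`, and `exp t = 4 / 3` is the
optimal choice in the Chernoff bound. -/
theorem isSparsityConstant_log_sub : IsSparsityConstant.{u} (Real.log (4 / 3) - 1 / 4) := by
  constructor
  · have h := Real.one_sub_inv_le_log_of_pos (x := 4 / 3) (by norm_num)
    have h2 : Real.log (4 / 3) ≠ 1 / 4 := by
      intro h
      have h3 := Real.log_lt_sub_one_of_pos (x := (4 / 3)⁻¹) (by norm_num) (by norm_num)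
      rw [Real.log_inv, h] at h3
      norm_num at h3
    norm_num at h
    rcases lt_or_eq_of_le h with h | h
    · linarith
    · exact absurd h.symm h2
  · intro d k A W Ω _ μ _ b _ _ hA _ hb
    have hlog : 0 ≤ Real.log (4 / 3) := Real.log_nonneg (by norm_num)
    have h := hb.measureReal_compl_sparseEvent_le (inclusionProb_nonneg hA W k) k hlog
    rw [Real.exp_log (by norm_num)] at h
    have h2 : Real.exp (-Real.log (4 / 3) * k + (4 / 3 - 1) * ∑ i, inclusionProb A W k i)
        ≤ Real.exp (-(Real.log (4 / 3) - 1 / 4) * k) := by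
      rw [Real.exp_le_exp]
      linarith [sum_inclusionProb_le hA W k]
    rw [measureReal_compl (measurableSet_sparseEvent hb.measurable k), probReal_univ] at h
    linarith

/-! ### Quadratic forms and sparse optima -/

section QuadForm

variable {d : ℕ} {A : Matrix (Fin d) (Fin d) ℝ}

lemma quadForm_eq_sum (A : Matrix (Fin d) (Fin d) ℝ) (x : EuclideanSpace ℝ (Fin d)) :
    quadForm A x = ∑ i, ∑ j, A i j * (x i * x j) := by
  simp only [quadForm, dotProduct, Matrix.mulVec, Finset.mul_sum]
  exact Finset.sum_congr rfl fun i _ => Finset.sum_congr rfl fun j _ => by ring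

lemma quadForm_eq_inner (A : Matrix (Fin d) (Fin d) ℝ) (x : EuclideanSpace ℝ (Fin d)) :
    quadForm A x = inner ℝ x (Matrix.toEuclideanCLM (n := Fin d) (𝕜 := ℝ) A x) := by
  simp only [quadForm, PiLp.inner_apply, Matrix.ofLp_toEuclideanCLM, dotProduct]
  exact Finset.sum_congr rfl fun i _ => by simp [mul_comm]

lemma quadForm_smul (A : Matrix (Fin d) (Fin d) ℝ) (r : ℝ) (x : EuclideanSpace ℝ (Fin d)) :
    quadForm A (r • x) = r ^ 2 * quadForm A x := by
  simp only [quadForm_eq_sum, Finset.mul_sum, PiLp.smul_apply, smul_eq_mul]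
  exact Finset.sum_congr rfl fun i _ => Finset.sum_congr rfl fun j _ => by ring

lemma quadForm_le_norm_sq (hA : ‖Matrix.toEuclideanCLM (n := Fin d) (𝕜 := ℝ) A‖ = 1)
    (x : EuclideanSpace ℝ (Fin d)) : quadForm A x ≤ ‖x‖ ^ 2 := by
  rw [quadForm_eq_inner]
  have h := (Matrix.toEuclideanCLM (n := Fin d) (𝕜 := ℝ) A).le_opNorm x
  rw [hA, one_mul] at h
  calc _ ≤ ‖x‖ * ‖Matrix.toEuclideanCLM (n := Fin d) (𝕜 := ℝ) A x‖ := real_inner_le_norm _ _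
    _ ≤ ‖x‖ * ‖x‖ := by gcongr
    _ = ‖x‖ ^ 2 := (sq _).symm

lemma quadForm_single (A : Matrix (Fin d) (Fin d) ℝ) (i : Fin d) :
    quadForm A (EuclideanSpace.single i 1) = A i i := by
  simp [quadForm_eq_sum]

/-- Bounding a quadratic form by a multiple of `‖x‖²` on a set closed under scaling can be checked
on unit vectors. -/
lemma quadForm_le_mul_norm_sq {x : EuclideanSpace ℝ (Fin d)} {q : ℝ}
    (h : x ≠ 0 → quadForm A (‖x‖⁻¹ • x) ≤ q) : quadForm A x ≤ q * ‖x‖ ^ 2 := by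
  by_cases hx : x = 0
  · simp [hx, quadForm]
  · have hn : 0 < ‖x‖ := norm_pos_iff.2 hx
    have h2 := h hx
    rwa [quadForm_smul, inv_pow, inv_mul_le_iff₀ (by positivity), mul_comm] at h2

lemma norm_inv_norm_smul {x : EuclideanSpace ℝ (Fin d)} (hx : x ≠ 0) : ‖‖x‖⁻¹ • x‖ = 1 := by
  rw [norm_smul, norm_inv, norm_norm, inv_mul_cancel₀ (norm_ne_zero_iff.2 hx)]

lemma zeroNorm_smul_le (r : ℝ) (x : EuclideanSpace ℝ (Fin d)) : zeroNorm (r • x) ≤ zeroNorm x := by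
  refine Finset.card_le_card fun i hi => Finset.mem_filter.2 ⟨Finset.mem_univ i, fun hx => ?_⟩
  exact (Finset.mem_filter.1 hi).2 (by simp [hx])

lemma zeroNorm_le_card {s : Finset (Fin d)} {x : EuclideanSpace ℝ (Fin d)}
    (h : ∀ i, i ∉ s → x i = 0) : zeroNorm x ≤ s.card := by
  refine Finset.card_le_card fun i hi => ?_
  by_contra his
  exact (Finset.mem_filter.1 hi).2 (h i his)

lemma IsOptimal.quadForm_le {k : ℕ} {x : EuclideanSpace ℝ (Fin d)} (hx : IsOptimal A k x)
    {y : EuclideanSpace ℝ (Fin d)} (hy : zeroNorm y ≤ k) :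
    quadForm A y ≤ quadForm A x * ‖y‖ ^ 2 :=
  quadForm_le_mul_norm_sq fun h =>
    hx.2 _ ⟨norm_inv_norm_smul h, (zeroNorm_smul_le _ _).trans hy⟩

lemma IsOptimal.diag_le {k : ℕ} {x : EuclideanSpace ℝ (Fin d)} (hx : IsOptimal A k x)
    (hk : 0 < k) (i : Fin d) : A i i ≤ quadForm A x := by
  have h := hx.quadForm_le (y := EuclideanSpace.single i 1) (by
    refine (zeroNorm_le_card (s := {i}) fun j hj => ?_).trans hk
    simpa using hj)
  simpa [quadForm_single] using h

/-- Testing on `eᵢ ± eⱼ` shows that, with two nonzero coordinates available, the optimum dominates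
every entry of a matrix with nonnegative diagonal. -/
lemma IsOptimal.abs_apply_le {k : ℕ} {x : EuclideanSpace ℝ (Fin d)} (hx : IsOptimal A k x)
    (hk : 2 ≤ k) (hA : ∀ i, 0 ≤ A i i) (hsymm : A.IsSymm) (i j : Fin d) :
    |A i j| ≤ quadForm A x := by
  by_cases hij : i = j
  · subst hij
    rw [abs_of_nonneg (hA i)]
    exact hx.diag_le (by omega) i
  · have key : ∀ s : ℝ, s ^ 2 = 1 → A i i + A j j + 2 * s * A i j ≤ quadForm A x * 2 := by
      intro s hs
      set y : EuclideanSpace ℝ (Fin d) := EuclideanSpace.single i 1 + EuclideanSpace.single j s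
        with hy
      have h0 : zeroNorm y ≤ k := by
        refine (zeroNorm_le_card (s := {i, j}) fun l hl => ?_).trans
          ((Finset.card_le_two).trans hk)
        simp only [Finset.mem_insert, Finset.mem_singleton, not_or] at hl
        simp [hy, hl.1, hl.2]
      have hn : ‖y‖ ^ 2 = 2 := by
        rw [EuclideanSpace.real_norm_sq_eq]
        have : ∀ l, y l ^ 2 = (if l = i then 1 else 0) + (if l = j then s ^ 2 else 0) := by
          intro l
          simp only [hy, PiLp.add_apply, PiLp.single_apply]
          by_cases h1 : l = i
          · simp [h1, hij]
          · by_cases h2 : l = j <;> simp [h1, h2]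
            · have hji : j ≠ i := fun h => hij h.symm
              simp [hji]
        simp only [this, Finset.sum_add_distrib, Finset.sum_ite_eq', Finset.mem_univ, if_true, hs]
        norm_num
      have hq : quadForm A y = A i i + A j j + 2 * s * A i j := by
        have hmv : ∀ l, (A *ᵥ y.ofLp) l = A l i + s * A l j := by
          intro l
          simp [hy, Matrix.mulVec, dotProduct, mul_add, Finset.sum_add_distrib,
            mul_comm]
        have hs2 : A j i = A i j := hsymm.apply i j
        have : quadForm A y = (A i i + s * A i j) + s * (A j i + s * A j j) := by
          simp only [quadForm, dotProduct, hmv]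
          simp [hy, add_mul, Finset.sum_add_distrib]
        rw [this, hs2]
        linear_combination A j j * hs
      have h := hx.quadForm_le h0
      rwa [hn, hq] at h
    have h1 := key 1 (by norm_num)
    have h2 := key (-1) (by norm_num)
    have := hA i
    have := hA j
    rw [abs_le]
    constructor <;> linarith

lemma norm_toEuclideanCLM_le_of_abs_le {m : ℝ} (hm : 0 ≤ m) (h : ∀ i j, |A i j| ≤ m) :
    ‖Matrix.toEuclideanCLM (n := Fin d) (𝕜 := ℝ) A‖ ≤ d * m := by
  refine ContinuousLinearMap.opNorm_le_bound _ (by positivity) fun v => ?_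
  refine le_of_sq_le_sq ?_ (by positivity)
  rw [EuclideanSpace.real_norm_sq_eq, mul_pow, EuclideanSpace.real_norm_sq_eq v]
  have hrow : ∀ i, (Matrix.toEuclideanCLM (n := Fin d) (𝕜 := ℝ) A v) i ^ 2
      ≤ d * m ^ 2 * ∑ j, v j ^ 2 := by
    intro i
    rw [Matrix.ofLp_toEuclideanCLM, Matrix.mulVec, dotProduct]
    calc (∑ j, A i j * v j) ^ 2 ≤ (∑ j, A i j ^ 2) * ∑ j, v j ^ 2 :=
          Finset.sum_mul_sq_le_sq_mul_sq _ _ _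
      _ ≤ (∑ _j : Fin d, m ^ 2) * ∑ j, v j ^ 2 := by
          refine mul_le_mul_of_nonneg_right (Finset.sum_le_sum fun j _ => ?_)
            (Finset.sum_nonneg fun j _ => sq_nonneg _)
          exact sq_le_sq' (by linarith [(abs_le.1 (h i j)).1]) (abs_le.1 (h i j)).2
      _ = d * m ^ 2 * ∑ j, v j ^ 2 := by simp
  calc _ ≤ ∑ _i : Fin d, d * m ^ 2 * ∑ j, v j ^ 2 := Finset.sum_le_sum fun i _ => hrow i
    _ = _ := by
      rw [Finset.sum_const, Finset.card_univ, Fintype.card_fin, nsmul_eq_mul]; ring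

/-- Some `k`-element subset carries at least the proportion `k / |s|` of a nonnegative sum. -/
lemma exists_subset_card_eq_mul_sum_le {ι : Type*} [DecidableEq ι] (f : ι → ℝ)
    (k : ℕ) (s : Finset ι) (hk : k ≤ s.card) :
    ∃ t ⊆ s, t.card = k ∧ k * ∑ i ∈ s, f i ≤ s.card * ∑ i ∈ t, f i := by
  by_cases hk0 : k = 0
  · exact ⟨∅, by simp, by simp [hk0], by simp [hk0]⟩
  have hkpos : (0 : ℝ) < k := by positivity
  induction s using Finset.strongInduction with
  | H s ih =>
    rcases eq_or_lt_of_le hk with h | h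
    · exact ⟨s, subset_rfl, h.symm, by rw [h]⟩
    · have hne : s.Nonempty := Finset.card_pos.1 (by omega)
      -- discarding the smallest term does not decrease the average
      obtain ⟨m, hm, hmin⟩ := s.exists_min_image f hne
      have hcard := Finset.card_erase_of_mem hm
      obtain ⟨t, hts, htk, ht⟩ := ih (s.erase m) (Finset.erase_ssubset hm) (by omega)
      refine ⟨t, hts.trans (Finset.erase_subset _ _), htk, ?_⟩
      have hsum := Finset.add_sum_erase s f hm
      have hlow : (s.card : ℝ) * f m ≤ ∑ i ∈ s, f i := by
        rw [← nsmul_eq_mul]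
        exact Finset.card_nsmul_le_sum _ _ _ hmin
      have hc : ((s.erase m).card : ℝ) = s.card - 1 := by
        rw [hcard, Nat.cast_sub (by omega)]; simp
      have hc1 : (0 : ℝ) < s.card - 1 := by
        have : (2 : ℝ) ≤ s.card := by exact_mod_cast (by omega : 2 ≤ s.card)
        linarith
      rw [hc] at ht
      have h1 : (s.card - 1 : ℝ) * ∑ i ∈ s, f i ≤ s.card * ∑ i ∈ s.erase m, f i := by
        rw [← hsum] at hlow ⊢
        linarith
      refine le_of_mul_le_mul_left ?_ hc1
      calc (s.card - 1 : ℝ) * (k * ∑ i ∈ s, f i) = k * ((s.card - 1 : ℝ) * ∑ i ∈ s, f i) := by ring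
        _ ≤ k * (s.card * ∑ i ∈ s.erase m, f i) := by gcongr
        _ = s.card * (k * ∑ i ∈ s.erase m, f i) := by ring
        _ ≤ s.card * ((s.card - 1 : ℝ) * ∑ i ∈ t, f i) := by gcongr
        _ = _ := by ring

/-- Cauchy–Schwarz for the form of a positive semidefinite matrix. -/
lemma sq_dotProduct_mulVec_le (hA : A.PosSemidef) (u v : Fin d → ℝ) :
    (u ⬝ᵥ A *ᵥ v) ^ 2 ≤ (u ⬝ᵥ A *ᵥ u) * (v ⬝ᵥ A *ᵥ v) := by
  have hs : v ⬝ᵥ A *ᵥ u = u ⬝ᵥ A *ᵥ v := by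
    have hAt : Aᵀ = A := by simpa [Matrix.conjTranspose_eq_transpose_of_trivial] using hA.1.eq
    rw [Matrix.dotProduct_mulVec, ← Matrix.mulVec_transpose, hAt, dotProduct_comm]
  have h : ∀ t : ℝ, 0 ≤ (v ⬝ᵥ A *ᵥ v) * (t * t) + (2 * (u ⬝ᵥ A *ᵥ v)) * t + u ⬝ᵥ A *ᵥ u := by
    intro t
    have h := hA.dotProduct_mulVec_nonneg (u + t • v)
    simp only [star_trivial, Matrix.mulVec_add, Matrix.mulVec_smul, dotProduct_add, add_dotProduct,
      dotProduct_smul, smul_dotProduct, smul_eq_mul, hs] at h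
    linarith
  have h2 := discrim_le_zero h
  rw [discrim] at h2
  linarith

/-- For every `v`, the `k` largest coordinates of `A v` form a sparse vector `y`. Applying
Cauchy–Schwarz to `yᵀ A v` bounds `‖A v‖²` by `d / k` times the optimum times `‖v‖²`. -/
lemma IsOptimal.div_le_of_posSemidef {k : ℕ} {x : EuclideanSpace ℝ (Fin d)} (hx : IsOptimal A k x)
    (hA : A.PosSemidef) (hk : 0 < k) (hkd : k ≤ d)
    (hn : ‖Matrix.toEuclideanCLM (n := Fin d) (𝕜 := ℝ) A‖ = 1) :
    (k : ℝ) / d ≤ quadForm A x := by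
  have hkpos : (0 : ℝ) < k := by exact_mod_cast hk
  have hdpos : (0 : ℝ) < d := by exact_mod_cast hk.trans_le hkd
  set Q := quadForm A x with hQ
  have hQ0 : 0 ≤ Q := by
    have := hA.dotProduct_mulVec_nonneg x.ofLp
    simpa [hQ, quadForm] using this
  have hb : ‖Matrix.toEuclideanCLM (n := Fin d) (𝕜 := ℝ) A‖ ≤ √(d / k * Q) := by
    refine ContinuousLinearMap.opNorm_le_bound _ (Real.sqrt_nonneg _) fun v => ?_
    refine le_of_sq_le_sq ?_ (by positivity)
    rw [mul_pow, Real.sq_sqrt (by positivity)]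
    set w := Matrix.toEuclideanCLM (n := Fin d) (𝕜 := ℝ) A v with hw
    obtain ⟨t, -, htk, ht⟩ := exists_subset_card_eq_mul_sum_le (fun i => w i ^ 2) k
      (Finset.univ : Finset (Fin d)) (by simpa using hkd)
    set y : EuclideanSpace ℝ (Fin d) := WithLp.toLp 2 fun i => if i ∈ t then w i else 0 with hy
    have hyn : ‖y‖ ^ 2 = ∑ i ∈ t, w i ^ 2 := by
      rw [EuclideanSpace.real_norm_sq_eq]
      simp [hy, ite_pow]
    have hyv : y.ofLp ⬝ᵥ A *ᵥ v.ofLp = ∑ i ∈ t, w i ^ 2 := by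
      have : A *ᵥ v.ofLp = w.ofLp := by rw [hw, Matrix.ofLp_toEuclideanCLM]
      rw [this]
      simp [hy, dotProduct, sq]
    have hcs := sq_dotProduct_mulVec_le hA y.ofLp v.ofLp
    rw [hyv] at hcs
    have h1 : y.ofLp ⬝ᵥ A *ᵥ y.ofLp ≤ Q * ∑ i ∈ t, w i ^ 2 := by
      rw [← hyn]
      exact hx.quadForm_le ((zeroNorm_le_card (s := t) fun i hi => by simp [hy, hi]).trans htk.le)
    have h2 : v.ofLp ⬝ᵥ A *ᵥ v.ofLp ≤ ‖v‖ ^ 2 := quadForm_le_norm_sq hn v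
    have h3 : 0 ≤ v.ofLp ⬝ᵥ A *ᵥ v.ofLp := by
      simpa using hA.dotProduct_mulVec_nonneg v.ofLp
    have hs0 : 0 ≤ ∑ i ∈ t, w i ^ 2 := Finset.sum_nonneg fun i _ => sq_nonneg _
    have h4 : ∑ i ∈ t, w i ^ 2 ≤ Q * ‖v‖ ^ 2 := by
      rcases hs0.eq_or_lt with h | h
      · rw [← h]; positivity
      · refine le_of_mul_le_mul_left ?_ h
        calc _ = (∑ i ∈ t, w i ^ 2) ^ 2 := (sq _).symm
          _ ≤ _ := hcs
          _ ≤ (Q * ∑ i ∈ t, w i ^ 2) * ‖v‖ ^ 2 := mul_le_mul h1 h2 h3 (by positivity)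
          _ = _ := by ring
    rw [EuclideanSpace.real_norm_sq_eq w]
    simp only [Finset.card_univ, Fintype.card_fin] at ht
    rw [show (d : ℝ) / k * Q * ‖v‖ ^ 2 = (d * (Q * ‖v‖ ^ 2)) / k by ring, le_div_iff₀ hkpos,
      mul_comm]
    exact ht.trans (by gcongr)
  rw [hn, Real.le_sqrt (by norm_num) (by positivity)] at hb
  rw [div_le_iff₀ hdpos]
  have h5 : (d : ℝ) / k * Q = (d * Q) / k := by ring
  rw [h5, le_div_iff₀ hkpos] at hb
  linarith

end QuadForm

/-! ### Outputs of the algorithm -/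

section Output

variable {d k : ℕ} {A : Matrix (Fin d) (Fin d) ℝ} {S : Finset (Fin d)}
  {z : EuclideanSpace ℝ (Fin d)}

lemma IsOutput.eq_zero_or_norm_eq_one (h : IsOutput A k S z) : z = 0 ∨ ‖z‖ = 1 := by
  obtain ⟨R, -, -, h3, h4⟩ := h
  rcases R.eq_empty_or_nonempty with hR | hR
  · left
    ext i
    exact h3 i (by simp [hR])
  · exact Or.inr (h4 hR).1

lemma IsOutput.norm_le_one (h : IsOutput A k S z) : ‖z‖ ≤ 1 := by
  rcases h.eq_zero_or_norm_eq_one with h | h <;> simp [h]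

lemma IsOutput.quadForm_nonneg (h : IsOutput A k S z) (hA : ∀ i, 0 ≤ A i i) :
    0 ≤ quadForm A z := by
  obtain ⟨R, -, -, h3, h4⟩ := h
  rcases R.eq_empty_or_nonempty with hR | ⟨i, hi⟩
  · have : z = 0 := by
      ext i
      exact h3 i (by simp [hR])
    simp [this, quadForm]
  · have := (h4 ⟨i, hi⟩).2 (EuclideanSpace.single i 1) (by simp) fun j hj => by
      have : j ≠ i := fun h => hj (h ▸ hi)
      simp [this]
    rw [quadForm_single] at this
    exact (hA i).trans this

lemma IsOutput.quadForm_le (h : IsOutput A k S z) {y : EuclideanSpace ℝ (Fin d)}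
    (hy : ∀ i, i ∉ S → y i = 0) : quadForm A y ≤ quadForm A z * ‖y‖ ^ 2 := by
  obtain ⟨R, h1, h2, h3, h4⟩ := h
  have hSR : S ⊆ R := by
    by_cases hc : A.PosSemidef ∧ S.card < k
    · exact (h1 hc).1
    · rw [h2 hc]
  refine quadForm_le_mul_norm_sq fun hy0 => ?_
  have hne : R.Nonempty := by
    by_contra hR
    rw [Finset.not_nonempty_iff_eq_empty] at hR
    refine hy0 ?_
    ext i
    exact hy i fun hi => by simpa [hR] using hSR hi
  refine (h4 hne).2 _ (norm_inv_norm_smul hy0) fun i hi => ?_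
  simp [hy i fun h => hi (hSR h)]

end Output

/-! ### The semidefinite relaxation -/

section Relaxation

variable {d k : ℕ} {A W : Matrix (Fin d) (Fin d) ℝ}

/-- A feasible point `x` of sparse PCA yields the feasible point `x xᵀ` of the relaxation. -/
lemma IsFeasible.quadForm_sub_le {ε : ℝ} {x : EuclideanSpace ℝ (Fin d)} (hx : IsFeasible k x)
    (hW : IsApproxSDPOptimal A k ε W) : quadForm A x - ε ≤ (A * W).trace := by
  have hn : ∑ i, x i ^ 2 = 1 := by
    rw [← EuclideanSpace.real_norm_sq_eq, hx.1, one_pow]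
  have hfeas : IsSDPFeasible k (Matrix.vecMulVec x.ofLp x.ofLp) := by
    refine ⟨?_, ?_, ?_⟩
    · simpa using Matrix.posSemidef_vecMulVec_self_star x.ofLp
    · simpa [Matrix.trace, Matrix.vecMulVec_apply, sq] using hn
    · simp only [Matrix.vecMulVec_apply, abs_mul]
      rw [← Finset.sum_mul_sum, ← sq]
      have h1 : ∑ i, |x i| = ∑ i with x i ≠ 0, |x i| := by
        rw [Finset.sum_filter]
        exact Finset.sum_congr rfl fun i _ => by
          by_cases h : x i = 0 <;> simp [h]
      rw [h1]
      refine sq_sum_le_card_mul_sum_sq.trans ?_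
      have h2 : ∑ i with x i ≠ 0, |x i| ^ 2 ≤ 1 := by
        rw [← hn]
        simp only [sq_abs]
        exact Finset.sum_le_sum_of_subset_of_nonneg (Finset.filter_subset _ _)
          fun i _ _ => sq_nonneg _
      have h3 : ((Finset.univ.filter fun i => x i ≠ 0).card : ℝ) ≤ k := Nat.cast_le.2 hx.2
      calc _ ≤ (k : ℝ) * 1 := by gcongr
        _ = k := mul_one _
  have h := hW.2 _ hfeas
  have htr : (A * Matrix.vecMulVec x.ofLp x.ofLp).trace = quadForm A x := by
    rw [quadForm_eq_sum]
    simp only [Matrix.trace, Matrix.diag_apply, Matrix.mul_apply, Matrix.vecMulVec_apply]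
    exact Finset.sum_congr rfl fun i _ => Finset.sum_congr rfl fun j _ => by ring
  rwa [htr] at h

/-- With trace `1` and entrywise `1`-norm at most `1` there is no room for off-diagonal entries. -/
lemma IsSDPFeasible.apply_eq_zero_of_ne (hW : IsSDPFeasible 1 W) {i j : Fin d} (hij : i ≠ j) :
    W i j = 0 := by
  obtain ⟨hpsd, htr, hsum⟩ := hW
  have h1 : ∀ i, ∑ j, |W i j| = W i i + ∑ j ∈ Finset.univ.erase i, |W i j| := by
    intro i
    rw [← Finset.add_sum_erase _ _ (Finset.mem_univ i), abs_of_nonneg hpsd.diag_nonneg]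
  simp only [h1, Finset.sum_add_distrib] at hsum
  have h2 : ∑ i, W i i = 1 := htr
  have h3 : ∑ i, ∑ j ∈ Finset.univ.erase i, |W i j| ≤ 0 := by
    rw [h2] at hsum
    push_cast at hsum
    linarith
  have h0 : ∀ i, 0 ≤ ∑ j ∈ Finset.univ.erase i, |W i j| :=
    fun i => Finset.sum_nonneg fun j _ => abs_nonneg _
  have h4 := (Finset.sum_eq_zero_iff_of_nonneg fun i _ => h0 i).1
    (le_antisymm h3 (Finset.sum_nonneg fun i _ => h0 i)) i (Finset.mem_univ i)
  have h5 := (Finset.sum_eq_zero_iff_of_nonneg fun j _ => abs_nonneg _).1 h4 j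
    (Finset.mem_erase.2 ⟨hij.symm, Finset.mem_univ j⟩)
  exact abs_eq_zero.1 h5

/-- The matrix `W` is the Gram matrix of the columns of its square root. -/
lemma sum_sqrt_mul_sqrt (hW : W.PosSemidef) (i j : Fin d) :
    ∑ l, CFC.sqrt W l i * CFC.sqrt W l j = W i j := by
  have h1 : CFC.sqrt W * CFC.sqrt W = W := CFC.sqrt_mul_sqrt_self W hW.nonneg
  have h2 : (CFC.sqrt W).PosSemidef := Matrix.nonneg_iff_posSemidef.1 (CFC.sqrt_nonneg W)
  conv_rhs => rw [← h1]
  rw [Matrix.mul_apply]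
  refine Finset.sum_congr rfl fun l _ => ?_
  congr 1
  simpa using (h2.1.apply l i).symm

end Relaxation

/-! ### Bounds on the inclusion probabilities -/

section Weights

variable {d k : ℕ} {A W : Matrix (Fin d) (Fin d) ℝ}

lemma sq_sqrtDiagSum_le (hW : W.PosSemidef) (htr : W.trace = 1) : sqrtDiagSum W ^ 2 ≤ d := by
  have h := sq_sum_le_card_mul_sum_sq (s := Finset.univ) (f := fun i => √(W i i))
  have h2 : ∑ i, √(W i i) ^ 2 = 1 := by
    rw [← htr]
    exact Finset.sum_congr rfl fun i _ => Real.sq_sqrt hW.diag_nonneg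
  rw [h2] at h
  simpa [sqrtDiagSum] using h

lemma diag_div_sq_inclusionProb_le (hA : ∀ i, 0 ≤ A i i) (hW : W.PosSemidef) (hk : 0 < k)
    (i : Fin d) : W i i / inclusionProb A W k i ^ 2
      ≤ W i i + 9 * sqrtDiagSum W ^ 2 / (4 * k ^ 2) := by
  have hkpos : (0 : ℝ) < k := by exact_mod_cast hk
  have hWi : 0 ≤ W i i := hW.diag_nonneg
  set σ := sqrtDiagSum W with hσ
  have hσ0 : 0 ≤ σ := sqrtDiagSum_nonneg W
  set p := inclusionProb A W k i with hp
  by_cases ha : √(W i i) = 0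
  · have : W i i = 0 := (Real.sqrt_eq_zero hWi).1 ha
    rw [this, zero_div]
    positivity
  have hapos : 0 < √(W i i) := lt_of_le_of_ne (Real.sqrt_nonneg _) (Ne.symm ha)
  have hσpos : 0 < σ := hapos.trans_le
    (Finset.single_le_sum (f := fun j => √(W j j)) (fun _ _ => Real.sqrt_nonneg _)
      (Finset.mem_univ i))
  have hlow : min 1 (2 / 3 * (k * √(W i i) / σ)) ≤ p := by
    refine min_le_min_left _ (le_add_of_nonneg_right ?_)
    have h1 : 0 ≤ A.trace := Finset.sum_nonneg fun i _ => hA i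
    have h2 := hA i
    positivity
  rcases le_total 1 (2 / 3 * (k * √(W i i) / σ)) with h | h
  · rw [min_eq_left h] at hlow
    have : W i i / p ^ 2 ≤ W i i := div_le_self hWi (one_le_pow₀ hlow)
    have h2 : 0 ≤ 9 * σ ^ 2 / (4 * (k : ℝ) ^ 2) := by positivity
    linarith
  · rw [min_eq_right h] at hlow
    have hpos : 0 < 2 / 3 * (k * √(W i i) / σ) := by positivity
    calc W i i / p ^ 2 ≤ W i i / (2 / 3 * (k * √(W i i) / σ)) ^ 2 := by gcongr
      _ = 9 * σ ^ 2 / (4 * k ^ 2) := by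
        nth_rewrite 1 [← Real.sq_sqrt hWi]
        field_simp
        norm_num
      _ ≤ _ := by linarith

lemma sum_diag_div_sq_inclusionProb_le (hA : ∀ i, 0 ≤ A i i) (hW : W.PosSemidef)
    (htr : W.trace = 1) (hk : 0 < k) (s : Finset (Fin d)) :
    ∑ i ∈ s, W i i / inclusionProb A W k i ^ 2
      ≤ 1 + s.card * (9 * sqrtDiagSum W ^ 2 / (4 * k ^ 2)) := by
  have h : ∑ i ∈ s, W i i ≤ 1 := by
    rw [← htr]
    exact Finset.sum_le_sum_of_subset_of_nonneg (Finset.subset_univ s)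
      fun i _ _ => hW.diag_nonneg
  calc _ ≤ ∑ i ∈ s, (W i i + 9 * sqrtDiagSum W ^ 2 / (4 * k ^ 2)) :=
        Finset.sum_le_sum fun i _ => diag_div_sq_inclusionProb_le hA hW hk i
    _ = ∑ i ∈ s, W i i + s.card * (9 * sqrtDiagSum W ^ 2 / (4 * k ^ 2)) := by
        rw [Finset.sum_add_distrib, Finset.sum_const, nsmul_eq_mul]
    _ ≤ _ := by linarith

lemma diag_eq_zero_of_inclusionProb_eq_zero (hA : ∀ i, 0 ≤ A i i) (hW : W.PosSemidef) (hk : 0 < k)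
    {i : Fin d} (h : inclusionProb A W k i = 0) : W i i = 0 := by
  have hkpos : (0 : ℝ) < k := by exact_mod_cast hk
  have hWi : 0 ≤ W i i := hW.diag_nonneg
  by_contra hne
  have hapos : 0 < √(W i i) := Real.sqrt_pos.2 (lt_of_le_of_ne hWi (Ne.symm hne))
  have hσpos : 0 < sqrtDiagSum W := hapos.trans_le
    (Finset.single_le_sum (f := fun j => √(W j j)) (fun _ _ => Real.sqrt_nonneg _)
      (Finset.mem_univ i))
  have h1 : 0 ≤ A.trace := Finset.sum_nonneg fun i _ => hA i
  have h2 := hA i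
  have : 0 < inclusionProb A W k i := by
    unfold inclusionProb
    positivity
  exact this.ne' h

end Weights

/-! ### The rounded vector -/

section ColumnForm

variable {d : ℕ} {W : Matrix (Fin d) (Fin d) ℝ}

/-- The linear form `uᵢᵀ x`, where `uᵢ` is the `i`-th column of the square root of `W`. -/
noncomputable def columnForm (W : Matrix (Fin d) (Fin d) ℝ) (x : Fin d → ℝ) (i : Fin d) : ℝ :=
  ∑ j, CFC.sqrt W j i * x j

/-- The random vector with entries `εᵢ uᵢᵀ g / pᵢ` of the randomized rounding, for the outcome `t`
of the coins and the outcome `x` of `g`.  If `pᵢ = 0`, the entry is `0`. -/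
noncomputable def roundedVec (p : Fin d → ℝ) (W : Matrix (Fin d) (Fin d) ℝ) (t : Fin d → Bool)
    (x : Fin d → ℝ) : EuclideanSpace ℝ (Fin d) :=
  WithLp.toLp 2 fun i => headsIndicator (t i) / p i * columnForm W x i

lemma measurable_columnForm (W : Matrix (Fin d) (Fin d) ℝ) (i : Fin d) :
    Measurable fun x => columnForm W x i := by
  unfold columnForm
  fun_prop

lemma sum_sq_sqrt (hW : W.PosSemidef) (i : Fin d) : ∑ j, CFC.sqrt W j i ^ 2 = W i i := by
  simp only [sq, sum_sqrt_mul_sqrt hW]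

lemma sq_columnForm_le (hW : W.PosSemidef) (x : Fin d → ℝ) (i : Fin d) :
    columnForm W x i ^ 2 ≤ W i i * ∑ j, x j ^ 2 := by
  rw [← sum_sq_sqrt hW]
  exact Finset.sum_mul_sq_le_sq_mul_sq _ _ _

lemma norm_sq_roundedVec (p : Fin d → ℝ) (W : Matrix (Fin d) (Fin d) ℝ) (t : Fin d → Bool)
    (x : Fin d → ℝ) :
    ‖roundedVec p W t x‖ ^ 2 = ∑ i, headsIndicator (t i) / p i ^ 2 * columnForm W x i ^ 2 := by
  rw [EuclideanSpace.real_norm_sq_eq]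
  refine Finset.sum_congr rfl fun i _ => ?_
  simp only [roundedVec]
  rw [mul_pow, div_pow, sq (headsIndicator _), headsIndicator_sq]

end ColumnForm

/-! ### Moments of the rounded vector -/

section Rounding

variable {Ω : Type u} [MeasurableSpace Ω] {μ : Measure Ω} [IsProbabilityMeasure μ] {d : ℕ}
  {W : Matrix (Fin d) (Fin d) ℝ} {p : Fin d → ℝ} {b : Fin d → Ω → Bool} {g : Fin d → Ω → ℝ}

omit [IsProbabilityMeasure μ] in
lemma IsUniformSample.ae_sq_columnForm_le (hg : IsUniformSample μ g) (hW : W.PosSemidef) :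
    ∀ᵐ ω ∂μ, ∀ i, columnForm W (fun j => g j ω) i ^ 2 ≤ W i i * (3 * d) := by
  filter_upwards [hg.ae_abs_le] with ω hω i
  refine (sq_columnForm_le hW _ i).trans ?_
  have h : ∑ j, g j ω ^ 2 ≤ 3 * d := by
    calc ∑ j, g j ω ^ 2 ≤ ∑ _j : Fin d, (3 : ℝ) := Finset.sum_le_sum fun j _ => by
          have := pow_le_pow_left₀ (abs_nonneg _) (hω j) 2
          rwa [sq_abs, Real.sq_sqrt (by norm_num)] at this
      _ = 3 * d := by simp [mul_comm]
  exact mul_le_mul_of_nonneg_left h hW.diag_nonneg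

omit [IsProbabilityMeasure μ] in
lemma IsUniformSample.measurable_columnForm (hg : IsUniformSample μ g)
    (W : Matrix (Fin d) (Fin d) ℝ) (i : Fin d) :
    Measurable fun ω => columnForm W (fun j => g j ω) i :=
  (SparsePCA.measurable_columnForm W i).comp (measurable_pi_lambda _ hg.measurable)

lemma IsUniformSample.integrable_mul_columnForm (hg : IsUniformSample μ g) (hW : W.PosSemidef)
    (i j : Fin d) {f : Ω → ℝ} (hf : Measurable f) {r : ℝ} (hr : ∀ ω, |f ω| ≤ r) :
    Integrable (fun ω => f ω * (columnForm W (fun l => g l ω) i *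
      columnForm W (fun l => g l ω) j)) μ := by
  refine Integrable.of_bound ((hf.mul ((hg.measurable_columnForm W i).mul
    (hg.measurable_columnForm W j))).aestronglyMeasurable)
    (r * (√(W i i * (3 * d)) * √(W j j * (3 * d)))) ?_
  filter_upwards [hg.ae_sq_columnForm_le hW] with ω hω
  rw [Real.norm_eq_abs, abs_mul, abs_mul]
  have h0 : 0 ≤ r := (abs_nonneg _).trans (hr ω)
  have h1 := Real.abs_le_sqrt (hω i)
  have h2 := Real.abs_le_sqrt (hω j)
  have h3 := hr ω
  gcongr

/-- Since `g` has identity covariance, the linear forms `uᵢᵀ g` have covariance `W`. -/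
lemma IsUniformSample.integral_columnForm_mul (hg : IsUniformSample μ g) (hW : W.PosSemidef)
    (i j : Fin d) :
    ∫ ω, columnForm W (fun l => g l ω) i * columnForm W (fun l => g l ω) j ∂μ = W i j := by
  have hint : ∀ l m, Integrable (fun ω => g l ω * g m ω) μ := by
    intro l m
    refine Integrable.of_bound
      ((hg.measurable l).mul (hg.measurable m)).aestronglyMeasurable (√3 * √3) ?_
    filter_upwards [hg.ae_abs_le] with ω hω
    rw [Real.norm_eq_abs, abs_mul]
    exact mul_le_mul (hω l) (hω m) (abs_nonneg _) (Real.sqrt_nonneg _)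
  have h : ∀ ω, columnForm W (fun l => g l ω) i * columnForm W (fun l => g l ω) j
      = ∑ l, ∑ m, CFC.sqrt W l i * CFC.sqrt W m j * (g l ω * g m ω) := by
    intro ω
    rw [columnForm, columnForm, Finset.sum_mul_sum]
    exact Finset.sum_congr rfl fun l _ => Finset.sum_congr rfl fun m _ => by ring
  simp only [h]
  rw [integral_finsetSum _ fun l _ => integrable_finsetSum _ fun m _ => (hint l m).const_mul _,
    ← sum_sqrt_mul_sqrt hW]
  refine Finset.sum_congr rfl fun l _ => ?_
  rw [integral_finsetSum _ fun m _ => (hint l m).const_mul _]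
  simp only [integral_const_mul, hg.integral_mul]
  simp

omit [MeasurableSpace Ω] in
lemma sq_columnForm_le_of_mem_maxBoundEvent {C : ℝ} (hW : W.PosSemidef) {ω : Ω}
    (hω : ω ∈ maxBoundEvent C W g) (i : Fin d) :
    columnForm W (fun j => g j ω) i ^ 2 ≤ C * Real.log d * W i i := by
  have h := hω i
  rw [sum_sq_sqrt hW] at h
  rcases (hW.diag_nonneg (i := i)).eq_or_lt with h0 | h0
  · have := sq_columnForm_le hW (fun j => g j ω) i
    rw [← h0, zero_mul] at this
    rwa [← h0, mul_zero]
  · exact (div_le_iff₀ h0).1 (h h0)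

omit [IsProbabilityMeasure μ] in
/-- Integrals of products of a function of the coins with a function of `g` factor. -/
lemma integral_coin_mul_uniform (hb : IsCoinSample μ p b) (hg : IsUniformSample μ g)
    (hind : IndepFun (fun ω i => b i ω) (fun ω i => g i ω) μ) (F : (Fin d → Bool) → ℝ)
    {G : (Fin d → ℝ) → ℝ} (hG : Measurable G) :
    ∫ ω, F (fun i => b i ω) * G (fun i => g i ω) ∂μ
      = (∫ ω, F (fun i => b i ω) ∂μ) * ∫ ω, G (fun i => g i ω) ∂μ :=
  hind.integral_fun_comp_mul_comp (measurable_pi_lambda _ hb.measurable).aemeasurable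
    (measurable_pi_lambda _ hg.measurable).aemeasurable
    (measurable_of_countable F).aestronglyMeasurable hG.aestronglyMeasurable

lemma measurableSet_maxBoundSet (C : ℝ) (W : Matrix (Fin d) (Fin d) ℝ) :
    MeasurableSet (maxBoundEvent C W fun i (x : Fin d → ℝ) => x i) :=
  measurableSet_maxBoundEvent (fun i => measurable_pi_apply i) C W

lemma roundedVec_mul (p : Fin d → ℝ) (W : Matrix (Fin d) (Fin d) ℝ) (t : Fin d → Bool)
    (x : Fin d → ℝ) (i j : Fin d) :
    roundedVec p W t x i * roundedVec p W t x j
      = headsIndicator (t i) / p i * (headsIndicator (t j) / p j)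
        * (columnForm W x i * columnForm W x j) := by
  simp only [roundedVec]
  ring

lemma integrable_roundedVec_mul (hb : IsCoinSample μ p b) (hg : IsUniformSample μ g)
    (hW : W.PosSemidef) (hp : ∀ i, 0 ≤ p i) (i j : Fin d) :
    Integrable (fun ω => roundedVec p W (fun l => b l ω) (fun l => g l ω) i *
      roundedVec p W (fun l => b l ω) (fun l => g l ω) j) μ := by
  simp only [roundedVec_mul]
  refine hg.integrable_mul_columnForm hW i j (r := 1 / p i * (1 / p j))
    (((measurable_headsIndicator.comp (hb.measurable i)).div_const _).mul
    ((measurable_headsIndicator.comp (hb.measurable j)).div_const _)) fun ω => ?_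
  have h1 := headsIndicator_nonneg (b i ω)
  have h2 := headsIndicator_nonneg (b j ω)
  have h3 := headsIndicator_le_one (b i ω)
  have h4 := headsIndicator_le_one (b j ω)
  have h5 := hp i
  have h6 := hp j
  rw [abs_of_nonneg (by positivity)]
  gcongr

omit [IsProbabilityMeasure μ] in
lemma integrable_quadForm {Y : Ω → EuclideanSpace ℝ (Fin d)} (A : Matrix (Fin d) (Fin d) ℝ)
    (h : ∀ i j, Integrable (fun ω => Y ω i * Y ω j) μ) :
    Integrable (fun ω => quadForm A (Y ω)) μ := by
  simp only [quadForm_eq_sum]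
  exact integrable_finsetSum _ fun i _ => integrable_finsetSum _ fun j _ => (h i j).const_mul _

lemma integral_quadForm {ν : Measure Ω} {Y : Ω → EuclideanSpace ℝ (Fin d)}
    (A : Matrix (Fin d) (Fin d) ℝ) (h : ∀ i j, Integrable (fun ω => Y ω i * Y ω j) ν) :
    ∫ ω, quadForm A (Y ω) ∂ν = ∑ i, ∑ j, A i j * ∫ ω, Y ω i * Y ω j ∂ν := by
  simp only [quadForm_eq_sum]
  refine (integral_finsetSum _ fun i _ =>
    integrable_finsetSum _ fun j _ => (h i j).const_mul (A i j)).trans ?_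
  refine Finset.sum_congr rfl fun i _ => ?_
  refine (integral_finsetSum _ fun j _ => (h i j).const_mul (A i j)).trans ?_
  simp only [integral_const_mul]

/-- Averaging over the coins turns the rounded vector into `(uᵢᵀ g)ᵢ`, except that the diagonal
terms, which are nonnegative, are inflated by `1 / pᵢ`. -/
lemma setIntegral_quadForm_columnForm_le (hb : IsCoinSample μ p b) (hg : IsUniformSample μ g)
    (hind : IndepFun (fun ω i => b i ω) (fun ω i => g i ω) μ) (hW : W.PosSemidef)
    (hp : ∀ i, 0 ≤ p i) (hp1 : ∀ i, p i ≤ 1) (hp0 : ∀ i, p i = 0 → W i i = 0)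
    {A : Matrix (Fin d) (Fin d) ℝ} (hA : ∀ i, 0 ≤ A i i) (C : ℝ) :
    ∫ ω in maxBoundEvent C W g, quadForm A (WithLp.toLp 2 (columnForm W fun l => g l ω)) ∂μ
      ≤ ∫ ω in maxBoundEvent C W g,
        quadForm A (roundedVec p W (fun l => b l ω) fun l => g l ω) ∂μ := by
  have hB := measurableSet_maxBoundEvent hg.measurable C W
  rw [integral_quadForm A fun i j => (integrable_roundedVec_mul hb hg hW hp i j).restrict,
    integral_quadForm A fun i j => by
      simpa using (hg.integrable_mul_columnForm hW i j measurable_const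
        (f := fun _ => 1) (r := 1) (by simp)).restrict]
  refine Finset.sum_le_sum fun i _ => Finset.sum_le_sum fun j _ => ?_
  set G : (Fin d → ℝ) → ℝ := (maxBoundEvent C W fun i (x : Fin d → ℝ) => x i).indicator
    fun x => columnForm W x i * columnForm W x j with hGdef
  have hG : Measurable G := ((measurable_columnForm W i).mul (measurable_columnForm W j)).indicator
    (measurableSet_maxBoundSet C W)
  have hGg : ∫ ω in maxBoundEvent C W g,
      columnForm W (fun l => g l ω) i * columnForm W (fun l => g l ω) j ∂μ
      = ∫ ω, G (fun l => g l ω) ∂μ := (integral_indicator hB).symm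
  have hy : ∫ ω in maxBoundEvent C W g, roundedVec p W (fun l => b l ω) (fun l => g l ω) i *
      roundedVec p W (fun l => b l ω) (fun l => g l ω) j ∂μ
      = (if i = j then p i else p i * p j) / (p i * p j) * ∫ ω, G (fun l => g l ω) ∂μ := by
    rw [← hb.integral_headsIndicator_mul hp i j, ← integral_div, ← integral_coin_mul_uniform hb hg
      hind (fun t => headsIndicator (t i) * headsIndicator (t j) / (p i * p j)) hG,
      ← integral_indicator hB]
    refine integral_congr_ae (Filter.Eventually.of_forall fun ω => ?_)
    simp only [hGdef]
    by_cases hω : ω ∈ maxBoundEvent C W g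
    · have hω' : (fun l => g l ω) ∈ maxBoundEvent C W fun i (x : Fin d → ℝ) => x i := hω
      rw [Set.indicator_of_mem hω, Set.indicator_of_mem hω', roundedVec_mul]
      ring
    · have hω' : (fun l => g l ω) ∉ maxBoundEvent C W fun i (x : Fin d → ℝ) => x i := hω
      rw [Set.indicator_of_notMem hω, Set.indicator_of_notMem hω', mul_zero]
  change A i j * ∫ ω in maxBoundEvent C W g,
    columnForm W (fun l => g l ω) i * columnForm W (fun l => g l ω) j ∂μ ≤ _
  rw [hy, hGg]
  -- a column with `pᵢ = 0` is zero, so that it contributes nothing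
  have hzero : ∀ l, p l = 0 → ∀ x, columnForm W x l = 0 := by
    intro l hl x
    have := sq_columnForm_le hW x l
    rw [hp0 l hl, zero_mul] at this
    exact pow_eq_zero_iff two_ne_zero |>.1 (le_antisymm this (sq_nonneg _))
  by_cases hij : p i = 0 ∨ p j = 0
  · have : ∀ x, G x = 0 := by
      intro x
      rcases hij with h | h <;> simp [hGdef, hzero _ h]
    simp [this]
  push Not at hij
  by_cases h : i = j
  · subst h
    simp only [if_true]
    have hpi : 0 < p i := lt_of_le_of_ne (hp i) (Ne.symm hij.1)
    have hG0 : 0 ≤ ∫ ω, G (fun l => g l ω) ∂μ := integral_nonneg fun ω =>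
      Set.indicator_nonneg (fun x _ => mul_self_nonneg _) _
    refine mul_le_mul_of_nonneg_left (le_mul_of_one_le_left hG0 ?_) (hA i)
    rw [one_le_div (by positivity)]
    exact mul_le_of_le_one_left (hp i) (hp1 i)
  · rw [if_neg h, div_self (mul_ne_zero hij.1 hij.2), one_mul]

/-- On the event that too many indices are sampled, the rounded vector has small second moment. -/
lemma setIntegral_norm_sq_roundedVec_le (hb : IsCoinSample μ p b) (hg : IsUniformSample μ g)
    (hind : IndepFun (fun ω i => b i ω) (fun ω i => g i ω) μ) (hW : W.PosSemidef) (k : ℕ) :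
    ∫ ω in (sparseEvent k b)ᶜ, ‖roundedVec p W (fun l => b l ω) fun l => g l ω‖ ^ 2 ∂μ
      ≤ μ.real (sparseEvent k b)ᶜ * ∑ i, W i i / p i ^ 2 := by
  have hS := (measurableSet_sparseEvent hb.measurable k).compl
  set E : Set (Fin d → Bool) := (sparseEvent k fun i (t : Fin d → Bool) => t i)ᶜ with hE
  simp only [norm_sq_roundedVec]
  have hint : ∀ i, Integrable (fun ω => headsIndicator (b i ω) / p i ^ 2 *
      columnForm W (fun l => g l ω) i ^ 2) μ := by
    intro i
    simp only [sq (columnForm _ _ _)]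
    refine hg.integrable_mul_columnForm hW i i (r := 1 / p i ^ 2)
      ((measurable_headsIndicator.comp (hb.measurable i)).div_const _) fun ω => ?_
    have h1 := headsIndicator_nonneg (b i ω)
    have h3 := headsIndicator_le_one (b i ω)
    rw [abs_of_nonneg (by positivity)]
    gcongr
  rw [integral_finsetSum _ fun i _ => (hint i).restrict, Finset.mul_sum]
  refine Finset.sum_le_sum fun i _ => ?_
  set F : (Fin d → Bool) → ℝ := E.indicator fun t => headsIndicator (t i) / p i ^ 2 with hF
  have h1 : ∫ ω in (sparseEvent k b)ᶜ, headsIndicator (b i ω) / p i ^ 2 *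
      columnForm W (fun l => g l ω) i ^ 2 ∂μ
      = (∫ ω, F (fun l => b l ω) ∂μ) * W i i := by
    rw [← integral_indicator hS, ← hg.integral_columnForm_mul hW i i,
      ← integral_coin_mul_uniform hb hg hind F
        (G := fun x => columnForm W x i * columnForm W x i)
        ((measurable_columnForm W i).mul (measurable_columnForm W i))]
    refine integral_congr_ae (Filter.Eventually.of_forall fun ω => ?_)
    simp only [hF]
    by_cases hω : ω ∈ (sparseEvent k b)ᶜ
    · have hω' : (fun l => b l ω) ∈ E := hω
      rw [Set.indicator_of_mem hω, Set.indicator_of_mem hω', sq (columnForm _ _ _)]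
    · have hω' : (fun l => b l ω) ∉ E := hω
      rw [Set.indicator_of_notMem hω, Set.indicator_of_notMem hω', zero_mul]
  have h2 : ∫ ω, F (fun l => b l ω) ∂μ ≤ μ.real (sparseEvent k b)ᶜ * (1 / p i ^ 2) := by
    have : ∫ ω in (sparseEvent k b)ᶜ, 1 / p i ^ 2 ∂μ
        = μ.real (sparseEvent k b)ᶜ * (1 / p i ^ 2) := by
      rw [setIntegral_const, smul_eq_mul]
    rw [← this]
    change ∫ ω, ((sparseEvent k b)ᶜ).indicator (fun ω => headsIndicator (b i ω) / p i ^ 2) ω ∂μ ≤ _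
    rw [integral_indicator hS]
    refine integral_mono_of_nonneg (Filter.Eventually.of_forall fun ω =>
      div_nonneg (headsIndicator_nonneg _) (sq_nonneg _)) (integrable_const _)
      (Filter.Eventually.of_forall fun ω => ?_)
    have h3 := headsIndicator_le_one (b i ω)
    change headsIndicator (b i ω) / p i ^ 2 ≤ 1 / p i ^ 2
    gcongr
  rw [h1]
  calc _ ≤ μ.real (sparseEvent k b)ᶜ * (1 / p i ^ 2) * W i i :=
        mul_le_mul_of_nonneg_right h2 hW.diag_nonneg
    _ = _ := by ring

/-- The value of the rounded vector, integrated over the good event, almost reaches the value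
`tr (A W)` of the relaxation. -/
theorem trace_sub_le_setIntegral_quadForm_roundedVec (hb : IsCoinSample μ p b)
    (hg : IsUniformSample μ g) (hind : IndepFun (fun ω i => b i ω) (fun ω i => g i ω) μ)
    (hW : W.PosSemidef) (htr : W.trace = 1)
    (hp : ∀ i, 0 ≤ p i) (hp1 : ∀ i, p i ≤ 1) (hp0 : ∀ i, p i = 0 → W i i = 0)
    {A : Matrix (Fin d) (Fin d) ℝ} (hA : ∀ i, 0 ≤ A i i) {q : ℝ} (hq0 : 0 ≤ q) (hq1 : q ≤ 1)
    (hq : ∀ y, quadForm A y ≤ q * ‖y‖ ^ 2) (C : ℝ) (k : ℕ) :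
    (A * W).trace - q * (3 * d) * μ.real (maxBoundEvent C W g)ᶜ
        - μ.real (sparseEvent k b)ᶜ * ∑ i, W i i / p i ^ 2
      ≤ ∫ ω in sparseEvent k b ∩ maxBoundEvent C W g,
        quadForm A (roundedVec p W (fun l => b l ω) fun l => g l ω) ∂μ := by
  have hB := measurableSet_maxBoundEvent hg.measurable C W
  have hS := measurableSet_sparseEvent hb.measurable k
  set Y : Ω → EuclideanSpace ℝ (Fin d) := fun ω => roundedVec p W (fun l => b l ω) fun l => g l ω
    with hY
  set V : Ω → EuclideanSpace ℝ (Fin d) := fun ω => WithLp.toLp 2 (columnForm W fun l => g l ω)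
    with hV
  have hYint : ∀ i j, Integrable (fun ω => Y ω i * Y ω j) μ :=
    integrable_roundedVec_mul hb hg hW hp
  have hVint : ∀ i j, Integrable (fun ω => V ω i * V ω j) μ := fun i j => by
    simpa [hV] using hg.integrable_mul_columnForm hW i j measurable_const
      (f := fun _ => 1) (r := 1) (by simp)
  have hYq := integrable_quadForm A hYint
  have hVq := integrable_quadForm A hVint
  have hYn : Integrable (fun ω => ‖Y ω‖ ^ 2) μ := by
    simp only [EuclideanSpace.real_norm_sq_eq]
    simp only [sq]
    exact integrable_finsetSum _ fun i _ => hYint i i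
  -- splitting off the event that too many indices are sampled
  have h1 : ∫ ω in maxBoundEvent C W g, quadForm A (Y ω) ∂μ
      = ∫ ω in sparseEvent k b ∩ maxBoundEvent C W g, quadForm A (Y ω) ∂μ
        + ∫ ω in maxBoundEvent C W g \ sparseEvent k b, quadForm A (Y ω) ∂μ := by
    rw [Set.inter_comm]
    exact (integral_inter_add_sdiff hS hYq.integrableOn).symm
  have h2 : ∫ ω in maxBoundEvent C W g \ sparseEvent k b, quadForm A (Y ω) ∂μ
      ≤ μ.real (sparseEvent k b)ᶜ * ∑ i, W i i / p i ^ 2 := by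
    calc _ ≤ ∫ ω in maxBoundEvent C W g \ sparseEvent k b, ‖Y ω‖ ^ 2 ∂μ :=
          integral_mono hYq.restrict hYn.restrict fun ω =>
            (hq _).trans (mul_le_of_le_one_left (sq_nonneg _) hq1)
      _ ≤ ∫ ω in (sparseEvent k b)ᶜ, ‖Y ω‖ ^ 2 ∂μ :=
          setIntegral_mono_set hYn.integrableOn
            (Filter.Eventually.of_forall fun ω => sq_nonneg _)
            (Filter.Eventually.of_forall fun ω h => h.2)
      _ ≤ _ := setIntegral_norm_sq_roundedVec_le hb hg hind hW k
  have h3 : ∫ ω in maxBoundEvent C W g, quadForm A (V ω) ∂μ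
      ≤ ∫ ω in maxBoundEvent C W g, quadForm A (Y ω) ∂μ :=
    setIntegral_quadForm_columnForm_le hb hg hind hW hp hp1 hp0 hA C
  -- removing the restriction to the event bounding `g`
  have h4 := integral_add_compl hB hVq
  have h5 : ∫ ω, quadForm A (V ω) ∂μ = (A * W).trace := by
    rw [integral_quadForm A hVint]
    have : ∀ i j, ∫ ω, V ω i * V ω j ∂μ = W i j := hg.integral_columnForm_mul hW
    simp only [this, Matrix.trace, Matrix.diag_apply, Matrix.mul_apply]
    refine Finset.sum_congr rfl fun i _ => Finset.sum_congr rfl fun j _ => ?_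
    congr 1
    simpa using (hW.1.apply i j).symm
  have h6 : ∫ ω in (maxBoundEvent C W g)ᶜ, quadForm A (V ω) ∂μ
      ≤ q * (3 * d) * μ.real (maxBoundEvent C W g)ᶜ := by
    have : ∫ ω in (maxBoundEvent C W g)ᶜ, q * (3 * d) ∂μ
        = q * (3 * d) * μ.real (maxBoundEvent C W g)ᶜ := by
      rw [setIntegral_const, smul_eq_mul, mul_comm]
    rw [← this]
    refine integral_mono_ae hVq.restrict (integrable_const _) (ae_restrict_of_ae ?_)
    filter_upwards [hg.ae_sq_columnForm_le hW] with ω hω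
    refine (hq _).trans (mul_le_mul_of_nonneg_left ?_ hq0)
    rw [EuclideanSpace.real_norm_sq_eq]
    calc ∑ i, V ω i ^ 2 ≤ ∑ i, W i i * (3 * d) := Finset.sum_le_sum fun i _ => hω i
      _ = W.trace * (3 * d) := by rw [← Finset.sum_mul]; rfl
      _ = 3 * d := by rw [htr, one_mul]
  linarith

end Rounding

/-! ### Conditioning on the good event -/

section Conditioning

variable {Ω : Type u} [MeasurableSpace Ω] {μ : Measure Ω} [IsProbabilityMeasure μ]

/-- Conditioning only increases the integral of a nonnegative function over the event. -/
lemma setIntegral_le_mul_integral_cond {E : Set Ω} (hE : MeasurableSet E) (hE0 : μ E ≠ 0)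
    {f h : Ω → ℝ} (hf : Integrable f μ) (hh : Integrable h μ) (hf0 : ∀ ω, 0 ≤ f ω) {M : ℝ}
    (hM : 0 ≤ M) (hle : ∀ ω ∈ E, h ω ≤ M * f ω) :
    ∫ ω in E, h ω ∂μ ≤ M * ∫ ω, f ω ∂μ[|E] := by
  have h1 : ∫ ω, f ω ∂μ[|E] = (μ.real E)⁻¹ * ∫ ω in E, f ω ∂μ := by
    rw [ProbabilityTheory.cond, integral_smul_measure, ENNReal.toReal_inv, smul_eq_mul]
    rfl
  have h2 : 0 ≤ ∫ ω in E, f ω ∂μ := integral_nonneg hf0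
  have h3 : 0 < μ.real E := ENNReal.toReal_pos hE0 (measure_ne_top _ _)
  calc ∫ ω in E, h ω ∂μ ≤ ∫ ω in E, M * f ω ∂μ :=
        setIntegral_mono_on hh.integrableOn (hf.const_mul M).integrableOn hE hle
    _ = M * ∫ ω in E, f ω ∂μ := integral_const_mul _ _
    _ ≤ M * ((μ.real E)⁻¹ * ∫ ω in E, f ω ∂μ) :=
        mul_le_mul_of_nonneg_left
          (le_mul_of_one_le_left h2 ((one_le_inv₀ h3).2 measureReal_le_one)) hM
    _ = _ := by rw [h1]

variable {d : ℕ} {p : Fin d → ℝ} {b : Fin d → Ω → Bool} {g : Fin d → Ω → ℝ}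

omit [IsProbabilityMeasure μ] in
lemma measure_sparseEvent_inter_maxBoundEvent
    (hind : IndepFun (fun ω i => b i ω) (fun ω i => g i ω) μ) (k : ℕ) (C : ℝ)
    (W : Matrix (Fin d) (Fin d) ℝ) :
    μ (sparseEvent k b ∩ maxBoundEvent C W g)
      = μ (sparseEvent k b) * μ (maxBoundEvent C W g) :=
  hind.measure_inter_preimage_eq_mul
    (sparseEvent k fun i (t : Fin d → Bool) => t i)
    (maxBoundEvent C W fun i (x : Fin d → ℝ) => x i)
    (measurableSet_sparseEvent (fun i => measurable_pi_apply i) k)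
    (measurableSet_maxBoundSet C W)

end Conditioning

/-! ### Comparison of the rounded vector with the output -/

section Comparison

variable {Ω : Type u} {d k : ℕ} {A W : Matrix (Fin d) (Fin d) ℝ}
  {b : Fin d → Ω → Bool} {g : Fin d → Ω → ℝ}

/-- On the good event the rounded vector is supported on at most `k` coordinates, so that its norm
is controlled deterministically. -/
lemma norm_sq_roundedVec_le {C : ℝ} (hC : 0 ≤ C * Real.log d) (hA : ∀ i, 0 ≤ A i i)
    (hW : W.PosSemidef) (htr : W.trace = 1) (hk : 0 < k) {ω : Ω}
    (hω : ω ∈ sparseEvent k b ∩ maxBoundEvent C W g) :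
    ‖roundedVec (inclusionProb A W k) W (fun l => b l ω) fun l => g l ω‖ ^ 2
      ≤ C * Real.log d * (1 + 9 * sqrtDiagSum W ^ 2 / (4 * k)) := by
  have hkpos : (0 : ℝ) < k := by exact_mod_cast hk
  have hcard : ((sampledSet b ω).card : ℝ) ≤ k := Nat.cast_le.2 hω.1
  rw [norm_sq_roundedVec]
  calc ∑ i, headsIndicator (b i ω) / inclusionProb A W k i ^ 2 *
          columnForm W (fun l => g l ω) i ^ 2
      = ∑ i ∈ sampledSet b ω, columnForm W (fun l => g l ω) i ^ 2
          / inclusionProb A W k i ^ 2 := by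
        rw [sampledSet, Finset.sum_filter]
        refine Finset.sum_congr rfl fun i _ => ?_
        unfold headsIndicator
        split_ifs
        · ring
        · ring
    _ ≤ ∑ i ∈ sampledSet b ω, C * Real.log d * (W i i / inclusionProb A W k i ^ 2) := by
        refine Finset.sum_le_sum fun i _ => ?_
        rw [← mul_div_assoc]
        exact div_le_div_of_nonneg_right (sq_columnForm_le_of_mem_maxBoundEvent hW hω.2 i)
          (sq_nonneg _)
    _ = C * Real.log d * ∑ i ∈ sampledSet b ω, W i i / inclusionProb A W k i ^ 2 := by
        rw [Finset.mul_sum]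
    _ ≤ C * Real.log d * (1 + (sampledSet b ω).card * (9 * sqrtDiagSum W ^ 2 / (4 * k ^ 2))) :=
        mul_le_mul_of_nonneg_left (sum_diag_div_sq_inclusionProb_le hA hW htr hk _) hC
    _ ≤ C * Real.log d * (1 + k * (9 * sqrtDiagSum W ^ 2 / (4 * k ^ 2))) := by gcongr
    _ = _ := by
        field_simp

/-- For `k = 1` both the relaxation and the rounded vector only see the diagonal of `A`, whose
form is bounded by the optimum; for `k ≥ 2` the optimum is at least `1 / d`.  In both cases `A`
can be replaced by a matrix whose form is bounded by `d` times the optimum. -/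
lemma IsOptimal.exists_reduced_matrix {ε : ℝ} {x : EuclideanSpace ℝ (Fin d)}
    (hx : IsOptimal A k x) (hd : 0 < d) (hk : 0 < k) (hsymm : A.IsSymm)
    (hn : ‖Matrix.toEuclideanCLM (n := Fin d) (𝕜 := ℝ) A‖ = 1) (hA : ∀ i, 0 ≤ A i i)
    (hW : IsApproxSDPOptimal A k ε W) :
    ∃ (A' : Matrix (Fin d) (Fin d) ℝ) (q : ℝ), (∀ i, 0 ≤ A' i i) ∧ 0 ≤ q ∧ q ≤ 1 ∧
      q ≤ d * quadForm A x ∧ (∀ y, quadForm A' y ≤ q * ‖y‖ ^ 2) ∧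
      (A' * W).trace = (A * W).trace ∧
      ∀ y, zeroNorm y ≤ k → quadForm A' y = quadForm A y := by
  have hd1 : (1 : ℝ) ≤ d := by exact_mod_cast hd
  have hQ0 : 0 ≤ quadForm A x := (hA ⟨0, hd⟩).trans (hx.diag_le hk _)
  rcases (show 1 ≤ k from hk).eq_or_lt with h1 | h2
  · subst h1
    refine ⟨Matrix.diagonal fun i => A i i, quadForm A x, by simpa using hA, hQ0, ?_,
      le_mul_of_one_le_left hQ0 hd1, ?_, ?_, ?_⟩
    · have := quadForm_le_norm_sq hn x
      rwa [hx.1.1, one_pow] at this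
    · intro y
      rw [EuclideanSpace.real_norm_sq_eq, Finset.mul_sum, quadForm]
      simp only [dotProduct, Matrix.mulVec_diagonal]
      refine Finset.sum_le_sum fun i _ => ?_
      have := hx.diag_le hk i
      calc y i * (A i i * y i) = A i i * y i ^ 2 := by ring
        _ ≤ _ := mul_le_mul_of_nonneg_right this (sq_nonneg _)
    · simp only [Matrix.trace, Matrix.diag_apply, Matrix.mul_apply]
      refine Finset.sum_congr rfl fun i _ => Finset.sum_congr rfl fun j _ => ?_
      by_cases hij : i = j
      · subst hij; simp
      · rw [hW.1.apply_eq_zero_of_ne (Ne.symm hij), mul_zero, mul_zero]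
    · intro y hy
      rw [quadForm_eq_sum, quadForm_eq_sum]
      refine Finset.sum_congr rfl fun i _ => Finset.sum_congr rfl fun j _ => ?_
      by_cases hij : i = j
      · subst hij; simp
      · -- two distinct coordinates of a `1`-sparse vector cannot both be nonzero
        have : y i * y j = 0 := by
          by_contra hne
          refine hij (Finset.card_le_one.1 hy i ?_ j ?_)
          · exact Finset.mem_filter.2 ⟨Finset.mem_univ _, left_ne_zero_of_mul hne⟩
          · exact Finset.mem_filter.2 ⟨Finset.mem_univ _, right_ne_zero_of_mul hne⟩
        rw [this, mul_zero, mul_zero]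
  · refine ⟨A, 1, hA, zero_le_one, le_rfl, ?_, fun y => ?_, rfl, fun _ _ => rfl⟩
    · rw [← hn]
      exact norm_toEuclideanCLM_le_of_abs_le hQ0 (hx.abs_apply_le h2 hA hsymm)
    · rw [one_mul]
      exact quadForm_le_norm_sq hn y

end Comparison

/-! ### The approximation guarantee -/

/-- The first guarantee, with explicit constant `6`; the second one follows from it, since a
positive semidefinite matrix of norm `1` has optimum at least `k / d`. -/
theorem quadForm_sub_le_mul_integral_cond {c C : ℝ} (hc : IsSparsityConstant.{u} c)
    (hC : IsMaxBoundConstant.{u} C) {d k : ℕ} {A W : Matrix (Fin d) (Fin d) ℝ} {ε : ℝ}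
    {x : EuclideanSpace ℝ (Fin d)} {Ω : Type u} [MeasurableSpace Ω] {μ : Measure Ω}
    [IsProbabilityMeasure μ] {b : Fin d → Ω → Bool} {g : Fin d → Ω → ℝ}
    {z : Ω → EuclideanSpace ℝ (Fin d)} (hd : 2 ≤ d) (hk : 0 < k) (hkd : k ≤ d)
    (hsymm : A.IsSymm) (hn : ‖Matrix.toEuclideanCLM (n := Fin d) (𝕜 := ℝ) A‖ = 1)
    (hA : ∀ i, 0 ≤ A i i) (hx : IsOptimal A k x) (hW : IsApproxSDPOptimal A k ε W)
    (hb : IsCoinSample μ (inclusionProb A W k) b) (hg : IsUniformSample μ g)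
    (hind : IndepFun (fun ω i => b i ω) (fun ω i => g i ω) μ) (hz : Measurable z)
    (hout : ∀ ω, IsOutput A k (sampledSet b ω) (z ω)) :
    0 < μ (sparseEvent k b ∩ maxBoundEvent C W g) ∧
      (1 - 6 / d) * quadForm A x - ε - Real.exp (-c * k + 2 * Real.log (2 * d / k))
        ≤ C * Real.log d * (1 + 9 * sqrtDiagSum W ^ 2 / (4 * k)) *
          ∫ ω, quadForm A (z ω) ∂μ[|sparseEvent k b ∩ maxBoundEvent C W g] := by
  have hd2 : (2 : ℝ) ≤ d := by exact_mod_cast hd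
  have hd0 : (0 : ℝ) < d := by linarith
  have hkpos : (0 : ℝ) < k := by exact_mod_cast hk
  have hkd' : (k : ℝ) ≤ d := by exact_mod_cast hkd
  have hpsd := hW.1.1
  have htr := hW.1.2.1
  have hp := inclusionProb_nonneg hA W k
  have hS := measurableSet_sparseEvent hb.measurable k
  have hB := measurableSet_maxBoundEvent hg.measurable C W
  have hPA := hc.2 d k A W Ω μ b hk hsymm hA hpsd hb
  have hPB := hC.2 d W Ω μ g (by omega) hpsd hg
  have hCl : 0 ≤ C * Real.log d := mul_nonneg hC.1.le (Real.log_nonneg (by linarith))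
  have hpos : 0 < μ (sparseEvent k b ∩ maxBoundEvent C W g) := by
    rw [measure_sparseEvent_inter_maxBoundEvent hind]
    have h1 : 0 < μ.real (sparseEvent k b) := by
      refine lt_of_lt_of_le ?_ hPA
      rw [sub_pos, Real.exp_lt_one_iff]
      have := mul_pos hc.1 hkpos
      linarith
    have h2 : 0 < μ.real (maxBoundEvent C W g) := by
      refine lt_of_lt_of_le ?_ hPB
      rw [sub_pos, div_lt_one (by positivity)]
      calc (2 : ℝ) < 2 ^ 3 := by norm_num
        _ ≤ (d : ℝ) ^ 3 := by gcongr
    exact ENNReal.mul_pos (ENNReal.toReal_pos_iff.1 h1).1.ne' (ENNReal.toReal_pos_iff.1 h2).1.ne'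
  refine ⟨hpos, ?_⟩
  obtain ⟨A', q, hA', hq0, hq1, hqd, hq, htr', hsparse⟩ :=
    hx.exists_reduced_matrix (by omega) hk hsymm hn hA hW
  have hround := trace_sub_le_setIntegral_quadForm_roundedVec hb hg hind hpsd htr hp
    (fun i => min_le_left _ _) (fun i => diag_eq_zero_of_inclusionProb_eq_zero hA hpsd hk)
    hA' hq0 hq1 hq C k
  have hzint : Integrable (fun ω => quadForm A (z ω)) μ := by
    refine integrable_quadForm A fun i j => ?_
    have hm : ∀ i, Measurable fun ω => z ω i := fun i => by fun_prop
    refine Integrable.of_bound ((hm i).mul (hm j)).aestronglyMeasurable (1 * 1)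
      (Filter.Eventually.of_forall fun ω => ?_)
    have h1 : ∀ i, ‖z ω i‖ ≤ 1 := fun i => (PiLp.norm_apply_le _ i).trans (hout ω).norm_le_one
    rw [norm_mul]
    exact mul_le_mul (h1 i) (h1 j) (norm_nonneg _) zero_le_one
  have hcond := setIntegral_le_mul_integral_cond (hS.inter hB) hpos.ne' hzint
    (integrable_quadForm A' (integrable_roundedVec_mul hb hg hpsd hp))
    (fun ω => (hout ω).quadForm_nonneg hA)
    (M := C * Real.log d * (1 + 9 * sqrtDiagSum W ^ 2 / (4 * k))) (by positivity)
    (fun ω hω => by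
      have hsupp : ∀ i, i ∉ sampledSet b ω →
          roundedVec (inclusionProb A W k) W (fun l => b l ω) (fun l => g l ω) i = 0 := by
        intro i hi
        have : b i ω ≠ true := fun h => hi (Finset.mem_filter.2 ⟨Finset.mem_univ _, h⟩)
        simp [roundedVec, headsIndicator, this]
      rw [hsparse _ ((zeroNorm_le_card hsupp).trans hω.1), mul_comm]
      exact ((hout ω).quadForm_le hsupp).trans (mul_le_mul_of_nonneg_left
        (norm_sq_roundedVec_le hCl hA hpsd htr hk hω) ((hout ω).quadForm_nonneg hA)))
  refine le_trans ?_ (hround.trans hcond)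
  have h1 := hx.1.quadForm_sub_le hW
  -- the error due to the bound on `g`
  have h2 : q * (3 * d) * μ.real (maxBoundEvent C W g)ᶜ ≤ 6 / d * quadForm A x := by
    have hBc : μ.real (maxBoundEvent C W g)ᶜ ≤ 2 / (d : ℝ) ^ 3 := by
      rw [measureReal_compl hB, probReal_univ]
      linarith
    calc q * (3 * d) * μ.real (maxBoundEvent C W g)ᶜ
        ≤ d * quadForm A x * (3 * d) * (2 / (d : ℝ) ^ 3) := by
          have := hq0.trans hqd
          gcongr
      _ = 6 / d * quadForm A x := by
          field_simp
          ring
  -- the error due to sampling too many indices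
  have h3 : μ.real (sparseEvent k b)ᶜ * ∑ i, W i i / inclusionProb A W k i ^ 2
      ≤ Real.exp (-c * k + 2 * Real.log (2 * d / k)) := by
    have hSc : μ.real (sparseEvent k b)ᶜ ≤ Real.exp (-c * k) := by
      rw [measureReal_compl hS, probReal_univ]
      linarith
    have hsum : ∑ i, W i i / inclusionProb A W k i ^ 2 ≤ (2 * d / k) ^ 2 := by
      refine (sum_diag_div_sq_inclusionProb_le hA hpsd htr hk Finset.univ).trans ?_
      rw [Finset.card_univ, Fintype.card_fin]
      have hσ := sq_sqrtDiagSum_le hpsd htr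
      have hdk : 1 ≤ (d : ℝ) ^ 2 / k ^ 2 := by
        rw [one_le_div (by positivity)]
        gcongr
      calc 1 + d * (9 * sqrtDiagSum W ^ 2 / (4 * (k : ℝ) ^ 2))
          ≤ 1 + d * (9 * d / (4 * (k : ℝ) ^ 2)) := by gcongr
        _ = 1 + 9 / 4 * ((d : ℝ) ^ 2 / k ^ 2) := by ring
        _ ≤ 4 * ((d : ℝ) ^ 2 / k ^ 2) := by linarith
        _ = _ := by ring
    have hexp : Real.exp (-c * k + 2 * Real.log (2 * d / k))
        = Real.exp (-c * k) * (2 * d / k) ^ 2 := by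
      rw [Real.exp_add, two_mul (Real.log _), Real.exp_add, Real.exp_log (by positivity), sq]
    rw [hexp]
    exact mul_le_mul hSc hsum
      (Finset.sum_nonneg fun i _ => div_nonneg hpsd.diag_nonneg (sq_nonneg _)) (Real.exp_pos _).le
  rw [htr']
  linarith

end SparsePCA

theorem mainTheorem2 :
    (∃ c : ℝ, SparsePCA.IsSparsityConstant.{u} c) ∧
    (∃ C : ℝ, SparsePCA.IsMaxBoundConstant.{u} C) ∧
    ∃ K : ℝ, 0 < K ∧
      ∀ c C : ℝ, SparsePCA.IsSparsityConstant.{u} c → SparsePCA.IsMaxBoundConstant.{u} C →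
      ∀ (d k : ℕ) (A W : Matrix (Fin d) (Fin d) ℝ) (ε : ℝ) (x : EuclideanSpace ℝ (Fin d))
        (Ω : Type u) [MeasurableSpace Ω] (μ : Measure Ω) [IsProbabilityMeasure μ]
        (b : Fin d → Ω → Bool) (g : Fin d → Ω → ℝ) (z : Ω → EuclideanSpace ℝ (Fin d)),
      2 ≤ d → 0 < k → k ≤ d →
      A.IsSymm → ‖Matrix.toEuclideanCLM (n := Fin d) (𝕜 := ℝ) A‖ = 1 → (∀ i, 0 ≤ A i i) →
      SparsePCA.IsOptimal A k x →
      SparsePCA.IsApproxSDPOptimal A k ε W →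
      SparsePCA.IsCoinSample μ (SparsePCA.inclusionProb A W k) b →
      SparsePCA.IsUniformSample μ g →
      IndepFun (fun ω i => b i ω) (fun ω i => g i ω) μ →
      Measurable z →
      (∀ ω, SparsePCA.IsOutput A k (SparsePCA.sampledSet b ω) (z ω)) →
      0 < μ (SparsePCA.sparseEvent k b ∩ SparsePCA.maxBoundEvent C W g) ∧
      (1 - K / d) * SparsePCA.quadForm A x - ε
          - Real.exp (-c * k + 2 * Real.log (2 * d / k))
        ≤ C * Real.log d * (1 + 9 * SparsePCA.sqrtDiagSum W ^ 2 / (4 * k)) *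
          ∫ ω, SparsePCA.quadForm A (z ω)
            ∂μ[|SparsePCA.sparseEvent k b ∩ SparsePCA.maxBoundEvent C W g] ∧
      (A.PosSemidef → 3 * Real.log (d / k) + Real.log (Real.log d) ≤ c * k →
        (1 - K / Real.log d) * SparsePCA.quadForm A x - ε
          ≤ C * Real.log d * (1 + 9 * SparsePCA.sqrtDiagSum W ^ 2 / (4 * k)) *
            ∫ ω, SparsePCA.quadForm A (z ω)
              ∂μ[|SparsePCA.sparseEvent k b ∩ SparsePCA.maxBoundEvent C W g]) := by
  refine ⟨⟨_, SparsePCA.isSparsityConstant_log_sub⟩, ⟨_, SparsePCA.isMaxBoundConstant_twentyFour⟩,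
    10, by norm_num, ?_⟩
  intro c C hc hC d k A W ε x Ω _ μ _ b g z hd hk hkd hsymm hn hA hx hW hb hg hind hz hout
  obtain ⟨hpos, hmain⟩ := SparsePCA.quadForm_sub_le_mul_integral_cond hc hC hd hk hkd hsymm hn hA
    hx hW hb hg hind hz hout
  have hd2 : (2 : ℝ) ≤ d := by exact_mod_cast hd
  have hd0 : (0 : ℝ) < d := by linarith
  have hkpos : (0 : ℝ) < k := by exact_mod_cast hk
  have hQ0 : 0 ≤ SparsePCA.quadForm A x := (hA ⟨0, by omega⟩).trans (hx.diag_le hk _)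
  refine ⟨hpos, le_trans ?_ hmain, fun hpsd hck => le_trans ?_ hmain⟩
  · have : (6 : ℝ) / d ≤ 10 / d := by gcongr; norm_num
    gcongr
  · have hlog : 0 < Real.log d := Real.log_pos (by linarith)
    have hQ := hx.div_le_of_posSemidef hpsd hk hkd hn
    have h1 : (6 : ℝ) / d ≤ 6 / Real.log d := by
      gcongr
      exact Real.log_le_self hd0.le
    -- the hypothesis on `c k` turns the failure probability into `(k / d)³ / log d`
    have h2 : Real.exp (-c * k + 2 * Real.log (2 * d / k))
        ≤ 4 / Real.log d * SparsePCA.quadForm A x := by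
      have hl : Real.log (2 * d / k) = Real.log 2 + Real.log (d / k) := by
        rw [mul_div_assoc, Real.log_mul (by norm_num) (by positivity)]
      calc Real.exp (-c * k + 2 * Real.log (2 * d / k))
          ≤ Real.exp (Real.log 2 + Real.log 2 - Real.log (d / k) - Real.log (Real.log d)) := by
            rw [Real.exp_le_exp, hl]
            linarith
        _ = 4 / Real.log d * (k / d) := by
            rw [Real.exp_sub, Real.exp_sub, Real.exp_add, Real.exp_log (by norm_num),
              Real.exp_log (by positivity), Real.exp_log hlog]
            field_simp
            norm_num
        _ ≤ _ := by gcongr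
    have h3 : 6 / d * SparsePCA.quadForm A x ≤ 6 / Real.log d * SparsePCA.quadForm A x := by
      gcongr
    have h4 : (1 - 10 / Real.log d) * SparsePCA.quadForm A x = SparsePCA.quadForm A x
        - 6 / Real.log d * SparsePCA.quadForm A x - 4 / Real.log d * SparsePCA.quadForm A x := by
      ring
    linarith
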